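/- Let $-\infty<a<b<\infty$, $I=(a,b)$, and let $E$ be a (real) Banach function space on $I$: a Banach space of classes of Lebesgue-measurable functions on $I$, whose norm $\|f\|_E\in[0,\infty]$ is defined for every measurable $f$, with $f\in E$ iff $\|f\|_E<\infty$, $\|f\|_E=0$ iff $f=0$ a.e., $\||f|\|_E=\|f\|_E$, $\|f\|_E\le\|g\|_E$ if $0\le f\le g$ a.e., $\|f_n\|_E\uparrow\|f\|_E$ if $0\le f_n\uparrow f$ a.e., and $L^\infty(I)\subset E\subset L^1(I)$. The associate space $E'$ consists of the measurable $g$ with $fg\in L^1(I)$ for all $f\in E$, normed by $\|g\|_{E'}=\sup\{\|fg\|_{L^1}:\|f\|_E\le1\}$; $E^*$ is the dual Banach space of $E$. A space $F\in\{E,E'\}$ has absolutely continuous norm if $\|f\chi_{X_n}\|_F\to0$ for all $f\in F$ and all measurable $X_n\subset I$ with $\chi_{X_n}\to0$ a.e. Suppose that $E$ belongs to the class $\mathcal M$, that is: (i) (Muckenhoupt condition) there is $C>0$ with $\frac1{|J|}\|\chi_J\|_E\|\chi_J\|_{E'}\le C$ for all intervals $J\subset I$ of positive length; (ii) (partition estimate)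 there is $C>0$ such that for all $f\in E$ and all finite or countable partitions $\{I_i\}$ of $I$ (up to a null set) into disjoint intervals (intervals of length zero contributing nothing), $$\frac1C\|f\|_E\le\Big\|\sum_i\frac{\|f\chi_{I_i}\|_E}{\|\chi_{I_i}\|_E}\chi_{I_i}\Big\|_E\le C\|f\|_E .$$ Suppose further that $E$ and $E^*$ are strictly convex and that $E$ and $E'$ have absolutely continuous norms. Then there are constants $C_1,C_2>0$, depending only on $E$, such that for all $u\in E'$ and $v\in E$ with $u>0$ and $v>0$ a.e. on $I$, the formula $Tf(x)=v(x)\int_a^x u(t)f(t)\,dt$ defines a bounded linear operator $T:E\to E$, the product $uv$ is integrable, and $$C_1\int_a^b u(x)v(x)\,dx\le\liminf_{n\to\infty}n\,s_n(T)\le\limsup_{n\to\infty}n\,s_n(T)\le C_2\int_a^b u(x)v(x)\,dx$$ (so in particular $C_1\int_a^b uv\,dx\le\limsup_{n\to\infty} n\,s_n(T)\le C_2\int_a^b uv\,dx$), where $s_n(T)$ is any of the following numbers of $T$: - the approximation numbers $a_n(T)=\inf\{\|T-P\|: P:E\to E \text{ bounded linear},\ \operatorname{rank}P<n\}$; - the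 isomorphism numbers $i_n(T)=\sup\|A\|^{-1}\|B\|^{-1}$, over all Banach spaces $G$ with $\dim G\ge n$ and bounded linear $A:E\to G$, $B:G\to E$ with $ATB=\mathrm{id}_G$; - the Gelfand numbers $c_n(T)=\inf\{\|T|_M\|: M\subset E \text{ closed},\ \operatorname{codim}M<n\}$; - the Bernstein numbers $b_n(T)=\sup\{j(T|_M): M\subset E\text{ closed},\ \dim M\ge n\}$, where $j(S)=\sup\{\rho\ge0:\|Sx\|\ge\rho\|x\|\text{ for all }x\}$; - the Kolmogorov numbers $d_n(T)=\inf\{\|Q_MT\|: M\subset E,\ \dim M<n\}$, where $Q_M:E\to E/M$ is the quotient map. -/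

import Mathlib

open Set Filter Topology MeasureTheory
open scoped NNReal ENNReal

noncomputable section

/-- Lebesgue measure on the interval `I = (a,b)`. -/
abbrev lebesgueOn (a b : ℝ) : Measure ℝ := volume.restrict (Ioo a b)

/-- A Banach function space on `(a,b)`. `fnorm f` is the (extended) norm of the measurable function
`f`; its values on non-measurable functions carry no information. -/
structure BanachFunctionSpace (a b : ℝ) where
  fnorm : (ℝ → ℝ) → ℝ≥0∞
  /-- the norm depends only on the class of `f` modulo equality a.e. -/
  fnorm_congr : ∀ f g : ℝ → ℝ, AEStronglyMeasurable f (lebesgueOn a b) →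
    AEStronglyMeasurable g (lebesgueOn a b) → f =ᵐ[lebesgueOn a b] g → fnorm f = fnorm g
  fnorm_add_le : ∀ f g : ℝ → ℝ, AEStronglyMeasurable f (lebesgueOn a b) →
    AEStronglyMeasurable g (lebesgueOn a b) → fnorm (f + g) ≤ fnorm f + fnorm g
  fnorm_smul : ∀ (c : ℝ) (f : ℝ → ℝ), AEStronglyMeasurable f (lebesgueOn a b) →
    fnorm (c • f) = ‖c‖ₑ * fnorm f
  fnorm_eq_zero_iff : ∀ f : ℝ → ℝ, AEStronglyMeasurable f (lebesgueOn a b) →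
    (fnorm f = 0 ↔ f =ᵐ[lebesgueOn a b] 0)
  fnorm_abs : ∀ f : ℝ → ℝ, AEStronglyMeasurable f (lebesgueOn a b) →
    fnorm (fun x => |f x|) = fnorm f
  fnorm_mono : ∀ f g : ℝ → ℝ, AEStronglyMeasurable f (lebesgueOn a b) →
    AEStronglyMeasurable g (lebesgueOn a b) →
    (∀ᵐ x ∂(lebesgueOn a b), 0 ≤ f x ∧ f x ≤ g x) → fnorm f ≤ fnorm g
  /-- Fatou property: `0 ≤ f n ↑ f` a.e. implies `‖f n‖ ↑ ‖f‖`. -/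
  fnorm_fatou : ∀ (F : ℕ → ℝ → ℝ) (f : ℝ → ℝ),
    (∀ n, AEStronglyMeasurable (F n) (lebesgueOn a b)) →
    AEStronglyMeasurable f (lebesgueOn a b) →
    (∀ᵐ x ∂(lebesgueOn a b), (∀ n, 0 ≤ F n x) ∧ Monotone (fun n => F n x) ∧
      Tendsto (fun n => F n x) atTop (𝓝 (f x))) →
    Tendsto (fun n => fnorm (F n)) atTop (𝓝 (fnorm f))
  /-- `L^∞ ⊆ E` -/
  bounded_mem : ∀ f : ℝ → ℝ, MemLp f ⊤ (lebesgueOn a b) → fnorm f < ⊤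
  /-- `E ⊆ L^1` -/
  mem_integrable : ∀ f : ℝ → ℝ, AEStronglyMeasurable f (lebesgueOn a b) →
    fnorm f < ⊤ → Integrable f (lebesgueOn a b)
  /-- `E` is complete -/
  complete : ∀ F : ℕ → ℝ → ℝ,
    (∀ n, AEStronglyMeasurable (F n) (lebesgueOn a b) ∧ fnorm (F n) < ⊤) →
    (∀ ε : ℝ≥0∞, 0 < ε → ∃ N, ∀ m ≥ N, ∀ n ≥ N, fnorm (F m - F n) < ε) →
    ∃ f : ℝ → ℝ, AEStronglyMeasurable f (lebesgueOn a b) ∧ fnorm f < ⊤ ∧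
      Tendsto (fun n => fnorm (F n - f)) atTop (𝓝 0)

namespace BanachFunctionSpace

variable {a b : ℝ}

/-- `f ∈ E`. -/
def Mem (E : BanachFunctionSpace a b) (f : ℝ → ℝ) : Prop :=
  AEStronglyMeasurable f (lebesgueOn a b) ∧ E.fnorm f < ⊤

/-- The classes (modulo equality a.e.) of the functions that belong to `E`. -/
def toSubmodule (E : BanachFunctionSpace a b) : Submodule ℝ (ℝ →ₘ[lebesgueOn a b] ℝ) where
  carrier := {f | E.fnorm f < ⊤}
  zero_mem' := by
    have h : E.fnorm ((0 : ℝ →ₘ[lebesgueOn a b] ℝ) : ℝ → ℝ) = 0 :=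
      (E.fnorm_eq_zero_iff _ (AEEqFun.aestronglyMeasurable _)).2 AEEqFun.coeFn_zero
    simp [h]
  add_mem' := by
    intro f g hf hg
    have h := E.fnorm_congr _ _ (AEEqFun.aestronglyMeasurable _)
      (f.aestronglyMeasurable.add g.aestronglyMeasurable) (AEEqFun.coeFn_add f g)
    simp only [mem_ofPred_eq] at *
    rw [h]
    exact (E.fnorm_add_le _ _ f.aestronglyMeasurable g.aestronglyMeasurable).trans_lt
      (ENNReal.add_lt_top.2 ⟨hf, hg⟩)
  smul_mem' := by
    intro c f hf
    have h := E.fnorm_congr _ _ (AEEqFun.aestronglyMeasurable _)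
      (f.aestronglyMeasurable.const_smul c) (AEEqFun.coeFn_smul c f)
    simp only [mem_ofPred_eq] at *
    rw [h, E.fnorm_smul c _ f.aestronglyMeasurable]
    exact ENNReal.mul_lt_top enorm_lt_top hf

/-- The Banach space `E`. -/
def Space (E : BanachFunctionSpace a b) : Type := E.toSubmodule

instance (E : BanachFunctionSpace a b) : AddCommGroup E.Space :=
  inferInstanceAs (AddCommGroup E.toSubmodule)

instance (E : BanachFunctionSpace a b) : Module ℝ E.Space :=
  inferInstanceAs (Module ℝ E.toSubmodule)

/-- The function class underlying an element of the Banach space `E`. -/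
def toFun (E : BanachFunctionSpace a b) (f : E.Space) : ℝ →ₘ[lebesgueOn a b] ℝ :=
  (show E.toSubmodule from f : E.toSubmodule).1

instance (E : BanachFunctionSpace a b) : CoeFun E.Space (fun _ => ℝ → ℝ) :=
  ⟨fun f => (E.toFun f : ℝ → ℝ)⟩

theorem fnorm_coe_lt_top (E : BanachFunctionSpace a b) (f : E.Space) : E.fnorm f < ⊤ :=
  (show E.toSubmodule from f : E.toSubmodule).2

theorem fnorm_coe_add_le (E : BanachFunctionSpace a b) (f g : E.Space) :
    E.fnorm (f + g : E.Space) ≤ E.fnorm f + E.fnorm g := by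
  have h := E.fnorm_congr _ _ (AEEqFun.aestronglyMeasurable _)
    ((E.toFun f).aestronglyMeasurable.add (E.toFun g).aestronglyMeasurable)
    (AEEqFun.coeFn_add (E.toFun f) (E.toFun g))
  exact h.trans_le (E.fnorm_add_le _ _ (E.toFun f).aestronglyMeasurable
    (E.toFun g).aestronglyMeasurable)

theorem fnorm_coe_smul (E : BanachFunctionSpace a b) (c : ℝ) (f : E.Space) :
    E.fnorm (c • f : E.Space) = ‖c‖ₑ * E.fnorm f := by
  have h := E.fnorm_congr _ _ (AEEqFun.aestronglyMeasurable _)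
    ((E.toFun f).aestronglyMeasurable.const_smul c) (AEEqFun.coeFn_smul c (E.toFun f))
  exact h.trans (E.fnorm_smul c _ (E.toFun f).aestronglyMeasurable)

theorem fnorm_coe_eq_zero (E : BanachFunctionSpace a b) (f : E.Space) :
    E.fnorm f = 0 ↔ f = 0 := by
  rw [E.fnorm_eq_zero_iff _ (E.toFun f).aestronglyMeasurable]
  constructor
  · intro h
    exact Subtype.ext (AEEqFun.ext (h.trans AEEqFun.coeFn_zero.symm))
  · rintro rfl
    exact AEEqFun.coeFn_zero

/-- The norm of the Banach space `E`. -/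
instance (E : BanachFunctionSpace a b) : NormedAddCommGroup E.Space :=
  AddGroupNorm.toNormedAddCommGroup
    { toFun := fun f => (E.fnorm f).toReal
      map_zero' := by rw [(E.fnorm_coe_eq_zero 0).2 rfl]; rfl
      add_le' := fun f g => by
        rw [← ENNReal.toReal_add (E.fnorm_coe_lt_top f).ne (E.fnorm_coe_lt_top g).ne]
        exact ENNReal.toReal_mono
          (ENNReal.add_lt_top.2 ⟨E.fnorm_coe_lt_top f, E.fnorm_coe_lt_top g⟩).ne
          (E.fnorm_coe_add_le f g)
      neg' := fun f => by
        have h := E.fnorm_coe_smul (-1) f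
        rw [neg_one_smul] at h
        simp [h]
      eq_zero_of_map_eq_zero' := fun f h => by
        rcases (ENNReal.toReal_eq_zero_iff _).1 h with h | h
        · exact (E.fnorm_coe_eq_zero f).1 h
        · exact absurd h (E.fnorm_coe_lt_top f).ne }

theorem norm_def (E : BanachFunctionSpace a b) (f : E.Space) : ‖f‖ = (E.fnorm f).toReal := rfl

instance (E : BanachFunctionSpace a b) : NormedSpace ℝ E.Space where
  norm_smul_le c f := by
    rw [norm_def, norm_def, fnorm_coe_smul, ENNReal.toReal_mul]
    simp

/-- `g ∈ E'`, where `E'` is the associate space: `f g` is integrable for every `f ∈ E`. -/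
def MemAssoc (E : BanachFunctionSpace a b) (g : ℝ → ℝ) : Prop :=
  AEStronglyMeasurable g (lebesgueOn a b) ∧
    ∀ f : ℝ → ℝ, E.Mem f → Integrable (fun x => f x * g x) (lebesgueOn a b)

/-- The norm of the associate space `E'`. -/
def assocNorm (E : BanachFunctionSpace a b) (g : ℝ → ℝ) : ℝ≥0∞ :=
  ⨆ (f : ℝ → ℝ) (_ : AEStronglyMeasurable f (lebesgueOn a b)) (_ : E.fnorm f ≤ 1),
    ∫⁻ x, ‖f x * g x‖ₑ ∂(lebesgueOn a b)

/-- Absolute continuity of the function norm `ρ` on the set of functions described by `mem`. -/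
def IsACNorm (a b : ℝ) (mem : (ℝ → ℝ) → Prop) (ρ : (ℝ → ℝ) → ℝ≥0∞) : Prop :=
  ∀ f : ℝ → ℝ, mem f → ∀ X : ℕ → Set ℝ, (∀ n, MeasurableSet (X n) ∧ X n ⊆ Ioo a b) →
    (∀ᵐ x ∂(lebesgueOn a b),
      Tendsto (fun n => (X n).indicator (fun _ => (1 : ℝ)) x) atTop (𝓝 0)) →
    Tendsto (fun n => ρ ((X n).indicator f)) atTop (𝓝 0)

/-- `E` has absolutely continuous norm. -/
def HasACNorm (E : BanachFunctionSpace a b) : Prop := IsACNorm a b E.Mem E.fnorm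

/-- The associate space `E'` has absolutely continuous norm. -/
def AssocHasACNorm (E : BanachFunctionSpace a b) : Prop := IsACNorm a b E.MemAssoc E.assocNorm

/-- The Muckenhoupt condition. -/
def Muckenhoupt (E : BanachFunctionSpace a b) : Prop :=
  ∃ C : ℝ, 0 < C ∧ ∀ c d : ℝ, a ≤ c → c < d → d ≤ b →
    (ENNReal.ofReal (d - c))⁻¹ *
      (E.fnorm ((Ioo c d).indicator fun _ => 1) * E.assocNorm ((Ioo c d).indicator fun _ => 1))
      ≤ ENNReal.ofReal C

/-- `Q` is a sequence of pairwise disjoint intervals whose union is `(a,b)` up to a null set;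
a finite partition is padded with empty intervals. -/
def IsIntervalPartition (a b : ℝ) (Q : ℕ → Set ℝ) : Prop :=
  (∀ i, (Q i).OrdConnected ∧ Q i ⊆ Ioo a b) ∧ Pairwise (fun i j => Disjoint (Q i) (Q j)) ∧
    volume (Ioo a b \ ⋃ i, Q i) = 0

/-- The function `∑ i, (‖f χ_{Q i}‖ / ‖χ_{Q i}‖) χ_{Q i}` (null intervals contribute `0`; at each
point at most one term of the sum is non-zero). -/
def partitionAverage (E : BanachFunctionSpace a b) (Q : ℕ → Set ℝ) (f : ℝ → ℝ) : ℝ → ℝ :=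
  fun x => ∑' i, (Q i).indicator
    (fun _ => (E.fnorm ((Q i).indicator f) / E.fnorm ((Q i).indicator fun _ => 1)).toReal) x

/-- The two-sided partition estimate, with a constant independent of `f` and of the partition. -/
def PartitionEstimate (E : BanachFunctionSpace a b) : Prop :=
  ∃ C : ℝ≥0, 0 < C ∧ ∀ f : ℝ → ℝ, E.Mem f → ∀ Q : ℕ → Set ℝ, IsIntervalPartition a b Q →
    (C : ℝ≥0∞)⁻¹ * E.fnorm f ≤ E.fnorm (E.partitionAverage Q f) ∧
      E.fnorm (E.partitionAverage Q f) ≤ C * E.fnorm f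

/-- The class `𝓜`. -/
def InClassM (E : BanachFunctionSpace a b) : Prop := E.Muckenhoupt ∧ E.PartitionEstimate

end BanachFunctionSpace

section SNumbers

universe u

variable {X : Type u} [NormedAddCommGroup X] [NormedSpace ℝ X]

/-- Approximation numbers. -/
def approximationNumber (n : ℕ) (S : X →L[ℝ] X) : ℝ≥0∞ :=
  ⨅ (P : X →L[ℝ] X) (_ : (P : X →ₗ[ℝ] X).rank < n), ‖S - P‖ₑ

/-- Isomorphism numbers. -/
def isomorphismNumber (n : ℕ) (S : X →L[ℝ] X) : ℝ≥0∞ :=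
  ⨆ (G : Type u) (_ : NormedAddCommGroup G) (_ : NormedSpace ℝ G) (_ : CompleteSpace G)
    (_ : (n : Cardinal) ≤ Module.rank ℝ G) (A : X →L[ℝ] G) (B : G →L[ℝ] X)
    (_ : A ∘L S ∘L B = ContinuousLinearMap.id ℝ G), ‖A‖ₑ⁻¹ * ‖B‖ₑ⁻¹

/-- Gelfand numbers. -/
def gelfandNumber (n : ℕ) (S : X →L[ℝ] X) : ℝ≥0∞ :=
  ⨅ (M : Submodule ℝ X) (_ : IsClosed (M : Set X)) (_ : Module.rank ℝ (X ⧸ M) < n),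
    ‖S ∘L M.subtypeL‖ₑ

/-- Modulus of injectivity. -/
def injectivityModulus {Y : Type u} [NormedAddCommGroup Y] [NormedSpace ℝ Y]
    (S : Y →L[ℝ] X) : ℝ≥0∞ :=
  ⨆ (ρ : ℝ≥0) (_ : ∀ x, ρ * ‖x‖ ≤ ‖S x‖), (ρ : ℝ≥0∞)

/-- Bernstein numbers. -/
def bernsteinNumber (n : ℕ) (S : X →L[ℝ] X) : ℝ≥0∞ :=
  ⨆ (M : Submodule ℝ X) (_ : IsClosed (M : Set X)) (_ : (n : Cardinal) ≤ Module.rank ℝ M),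
    injectivityModulus (S ∘L M.subtypeL)

/-- Kolmogorov numbers. -/
def kolmogorovNumber (n : ℕ) (S : X →L[ℝ] X) : ℝ≥0∞ :=
  ⨅ (M : Submodule ℝ X) (_ : IsClosed (M : Set X)) (_ : Module.rank ℝ M < n),
    ‖M.mkQL ∘L S‖ₑ

/-- The five kinds of s-numbers. -/
inductive SNumberKind
  | approximation
  | isomorphism
  | gelfand
  | kolmogorov
  | bernstein

/-- The `n`th s-number of the given kind (`n ≥ 1`). -/
def sNumber : SNumberKind → ℕ → (X →L[ℝ] X) → ℝ≥0∞
  | .approximation => approximationNumber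
  | .isomorphism => isomorphismNumber
  | .gelfand => gelfandNumber
  | .kolmogorov => kolmogorovNumber
  | .bernstein => bernsteinNumber

end SNumbers

end

/-! Among the five kinds of numbers the isomorphism numbers are the smallest and the approximation
numbers the largest, so it suffices to bound $n\,a_n(T)$ from above and $n\,i_n(T)$ from below, for
large $n$, by constant multiples of $\int uv$.

The partition estimate is used as a localisation principle (`CellwiseBound`): if $\|g\chi_J\|\le
c\|f\chi_J\|$ on each cell $J$ of a division, then $\|g\|\le Dc\|f\|$. By duality it gives
$\sum_J\|f\chi_J\|_E\|g\chi_J\|_{E'}\le 2D\|f\|_E\|g\|_{E'}$ (`CellwiseBound.sum_le`). Absolute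
continuity of both norms allows $u,v$ to be replaced by positive continuous $p,q$; the errors,
summed over any division, are controlled by this inequality. On intervals shorter than some $\eta$
the functions $p,q$ vary by a factor of at most 2, so Muckenhoupt's condition and Hölder's
inequality make $\|q\chi_J\|\|p\chi_J\|'$ comparable to $\int_J pq$. Only boundedly many cells of a
division are longer than $\eta$, which is negligible as $n\to\infty$.

Upper bound: if $\|v\chi_J\|\|u\chi_J\|'\le\varepsilon$ on $N<n$ cells, freezing the primitive at
the left end of each cell approximates $T$ with rank at most $N$ and error $D\varepsilon$
(`approximationNumber_hardy_le`). In a division with $N$ minimal, two adjacent cells together exceed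
$\varepsilon$, so $N\varepsilon$ is at most a multiple of $\int uv$, up to the long cells.

Lower bound: $\int pq$ is divided equally among $2n$ cells. On at least $n$ of them there is a
function $f$ for which $f$ and $Tf$ are both supported in the cell and $\|f\|\le\kappa\|Tf\|$ with
$\kappa$ of order $n/\int uv$ (`IsApprox.local_lower`). These functions, with functionals norming
the $Tf$, form a biorthogonal system, and localisation gives $i_n(T)\ge 1/(D\kappa)$
(`le_isomorphismNumber_hardy`). -/

/-! ### Comparison of the s-numbers -/

section SNumberComparison

universe u

variable {X : Type u} [NormedAddCommGroup X] [NormedSpace ℝ X]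

theorem exists_ne_zero_mem_ker_of_rank_lt {V W : Type u} [AddCommGroup V] [Module ℝ V]
    [AddCommGroup W] [Module ℝ W] (L : V →ₗ[ℝ] W)
    (h : L.rank < Module.rank ℝ V) : ∃ x, x ≠ 0 ∧ L x = 0 := by
  by_contra! hc
  have hinj : Function.Injective L := by
    rw [← LinearMap.ker_eq_bot, LinearMap.ker_eq_bot']
    intro x hx
    by_contra hne
    exact hc x hne hx
  exact absurd (rank_range_of_injective L hinj) h.ne

theorem enorm_inv_mul_inv_le {G : Type u} [NormedAddCommGroup G] [NormedSpace ℝ G]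
    {A : X →L[ℝ] G} {B : G →L[ℝ] X} {r : ℝ} (hpos : 0 < ‖A‖ * ‖B‖)
    (h : 1 ≤ r * (‖A‖ * ‖B‖)) : ‖A‖ₑ⁻¹ * ‖B‖ₑ⁻¹ ≤ ENNReal.ofReal r := by
  have hA : 0 < ‖A‖ := pos_of_mul_pos_left hpos (norm_nonneg _)
  have hB : 0 < ‖B‖ := pos_of_mul_pos_right hpos (norm_nonneg _)
  rw [← ofReal_norm, ← ofReal_norm, ← ENNReal.ofReal_inv_of_pos hA,
    ← ENNReal.ofReal_inv_of_pos hB, ← ENNReal.ofReal_mul (by positivity)]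
  apply ENNReal.ofReal_le_ofReal
  rw [← mul_inv, inv_le_iff_one_le_mul₀ hpos]
  exact h

theorem norm_pos_of_comp_eq_id {G : Type u} [NormedAddCommGroup G] [NormedSpace ℝ G]
    {S : X →L[ℝ] X} {A : X →L[ℝ] G} {B : G →L[ℝ] X}
    (h : A ∘L S ∘L B = ContinuousLinearMap.id ℝ G) {y : G} (hy : y ≠ 0) :
    0 < ‖A‖ * ‖B‖ := by
  have h1 : A (S (B y)) = y := congrArg (fun L : G →L[ℝ] G => L y) h
  have hA : A ≠ 0 := by
    rintro rfl
    exact hy (by simpa using h1.symm)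
  have hB : B ≠ 0 := by
    rintro rfl
    exact hy (by simpa using h1.symm)
  exact mul_pos (norm_pos_iff.2 hA) (norm_pos_iff.2 hB)

/-- Since `codim M < n ≤ dim G`, some `y ≠ 0` has `B y ∈ M`, and `‖y‖ = ‖A S B y‖ ≤ ‖A‖ ‖S|M‖ ‖B‖
‖y‖`. -/
theorem isomorphismNumber_le_gelfandNumber (n : ℕ) (S : X →L[ℝ] X) :
    isomorphismNumber n S ≤ gelfandNumber n S := by
  refine iSup_le fun G => iSup_le fun _ => iSup_le fun _ => iSup_le fun _ => iSup_le fun hG =>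
    iSup_le fun A => iSup_le fun B => iSup_le fun hAB => ?_
  refine le_iInf fun M => le_iInf fun _ => le_iInf fun hM => ?_
  obtain ⟨y, hy, hy0⟩ := exists_ne_zero_mem_ker_of_rank_lt (M.mkQ ∘ₗ (B : G →ₗ[ℝ] X))
    (((LinearMap.rank_le_range _).trans_lt hM).trans_le hG)
  have hmem : B y ∈ M := by simpa using hy0
  have h1 : A (S (B y)) = y := congrArg (fun L : G →L[ℝ] G => L y) hAB
  rw [← ofReal_norm (S ∘L M.subtypeL)]
  refine enorm_inv_mul_inv_le (norm_pos_of_comp_eq_id hAB hy) ?_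
  have h2 : ‖S (B y)‖ ≤ ‖S ∘L M.subtypeL‖ * ‖B y‖ := (S ∘L M.subtypeL).le_opNorm ⟨B y, hmem⟩
  have h3 : ‖y‖ ≤ ‖A‖ * ‖S (B y)‖ := by simpa [h1] using A.le_opNorm (S (B y))
  have h4 : ‖B y‖ ≤ ‖B‖ * ‖y‖ := B.le_opNorm y
  have hy' : 0 < ‖y‖ := norm_pos_iff.2 hy
  have : 1 * ‖y‖ ≤ (‖S ∘L M.subtypeL‖ * (‖A‖ * ‖B‖)) * ‖y‖ := by
    calc 1 * ‖y‖ ≤ ‖A‖ * (‖S ∘L M.subtypeL‖ * (‖B‖ * ‖y‖)) := by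
          rw [one_mul]
          refine h3.trans ?_
          gcongr
          exact h2.trans (by gcongr)
      _ = _ := by ring
  exact le_of_mul_le_mul_right this hy'

/-- The range of `B` serves as the subspace: the left inverse `A ∘ S` of `B` makes it closed, and
`S` is bounded below there by `‖A‖⁻¹ ‖B‖⁻¹`. -/
theorem isomorphismNumber_le_bernsteinNumber {n : ℕ} (hn : 0 < n) (S : X →L[ℝ] X) :
    isomorphismNumber n S ≤ bernsteinNumber n S := by
  refine iSup_le fun G => iSup_le fun _ => iSup_le fun _ => iSup_le fun _ => iSup_le fun hG =>
    iSup_le fun A => iSup_le fun B => iSup_le fun hAB => ?_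
  have h1 : ∀ y, A (S (B y)) = y := fun y => congrArg (fun L : G →L[ℝ] G => L y) hAB
  have hinj : Function.Injective B := fun x y hxy => by rw [← h1 x, hxy, h1]
  have hcl : IsClosed (B.range : Set X) := by
    have hanti : AntilipschitzWith ‖A ∘L S‖₊ B := by
      refine B.antilipschitz_of_bound fun x => ?_
      have := (A ∘L S).le_opNorm (B x)
      simpa [h1] using this
    have := hanti.isClosed_range B.uniformContinuous
    exact this
  have hrank : (n : Cardinal) ≤ Module.rank ℝ B.range :=
    hG.trans_eq (rank_range_of_injective (B : G →ₗ[ℝ] X) hinj).symm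
  refine le_iSup_of_le B.range (le_iSup_of_le hcl (le_iSup_of_le hrank ?_))
  refine le_iSup_of_le (‖A‖₊⁻¹ * ‖B‖₊⁻¹) ?_
  -- Here `n > 0` is needed: a nonzero vector forces `‖A‖` and `‖B‖` to be positive, so that their
  -- extended inverses are finite.
  have : Nontrivial G := by
    rw [← rank_pos_iff_nontrivial (R := ℝ)]
    exact lt_of_lt_of_le (by exact_mod_cast hn) hG
  obtain ⟨y, hy⟩ := exists_ne (0 : G)
  have hpos := norm_pos_of_comp_eq_id hAB hy
  have hA : 0 < ‖A‖ := pos_of_mul_pos_left hpos (norm_nonneg _)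
  have hB : 0 < ‖B‖ := pos_of_mul_pos_right hpos (norm_nonneg _)
  refine le_iSup_of_le ?_ ?_
  · rintro ⟨_, z, rfl⟩
    have h3 : ‖z‖ ≤ ‖A‖ * ‖S (B z)‖ := by simpa [h1] using A.le_opNorm (S (B z))
    have h4 : ‖B z‖ ≤ ‖B‖ * ‖z‖ := B.le_opNorm z
    change ‖A‖⁻¹ * ‖B‖⁻¹ * ‖B z‖ ≤ ‖S (B z)‖
    rw [← mul_inv, inv_mul_le_iff₀ hpos]
    nlinarith [mul_le_mul_of_nonneg_left h3 hB.le]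
  · rw [ENNReal.coe_mul, ENNReal.coe_inv (by simpa using hA.ne'),
      ENNReal.coe_inv (by simpa using hB.ne')]
    rfl

/-- The subspace `A(M)` has dimension below `n`, hence is closed and proper in `G`. A Riesz vector
`y` for it is almost as far from `A(M)` as from `0`, while this distance is at most `‖A‖ dist(S B y,
M)`. -/
theorem isomorphismNumber_le_kolmogorovNumber (n : ℕ) (S : X →L[ℝ] X) :
    isomorphismNumber n S ≤ kolmogorovNumber n S := by
  refine iSup_le fun G => iSup_le fun _ => iSup_le fun _ => iSup_le fun _ => iSup_le fun hG =>
    iSup_le fun A => iSup_le fun B => iSup_le fun hAB => ?_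
  refine le_iInf fun M => le_iInf fun _ => le_iInf fun hM => ?_
  have h1 : ∀ y, A (S (B y)) = y := fun y => congrArg (fun L : G →L[ℝ] G => L y) hAB
  have hfinM : FiniteDimensional ℝ M :=
    Module.rank_lt_aleph0_iff.1 (hM.trans (Cardinal.natCast_lt_aleph0))
  have hlt : Module.rank ℝ (M.map (A : X →ₗ[ℝ] G)) < Module.rank ℝ G :=
    ((rank_map_le _ _).trans_lt hM).trans_le hG
  have hne : ∃ y, y ∉ M.map (A : X →ₗ[ℝ] G) := by
    by_contra! hc
    rw [(Submodule.eq_top_iff').2 hc, rank_top] at hlt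
    exact hlt.false
  have hcl : IsClosed ((M.map (A : X →ₗ[ℝ] G) : Submodule ℝ G) : Set G) :=
    Submodule.closed_of_finiteDimensional _
  have hG0 : ∃ y : G, y ≠ 0 := by
    obtain ⟨y, hy⟩ := hne
    exact ⟨y, fun h => hy (h ▸ zero_mem _)⟩
  obtain ⟨y', hy'⟩ := hG0
  have hpos := norm_pos_of_comp_eq_id hAB hy'
  have hA : 0 < ‖A‖ := pos_of_mul_pos_left hpos (norm_nonneg _)
  rw [← ofReal_norm (M.mkQL ∘L S)]
  refine enorm_inv_mul_inv_le hpos (le_of_forall_lt_imp_le_of_dense fun r hr => ?_)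
  obtain ⟨y, hyM, hy⟩ := riesz_lemma hcl hne hr
  have hy0 : 0 < ‖y‖ := norm_pos_iff.2 fun h => hyM (h ▸ zero_mem _)
  refine le_of_mul_le_mul_right (le_of_forall_pos_le_add fun δ hδ => ?_) hy0
  -- The quotient norm need not be attained; `z` is a representative of the class of `S (B y)` whose
  -- norm is within `δ / ‖A‖` of it.
  obtain ⟨z, hz, hlt⟩ := Submodule.Quotient.norm_mk_lt (M.mkQ (S (B y))) (div_pos hδ hA)
  have hm : S (B y) - z ∈ M := by
    rw [← Submodule.Quotient.mk_eq_zero, Submodule.Quotient.mk_sub, hz]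
    simp
  have h2 : r * ‖y‖ ≤ ‖A‖ * ‖z‖ := by
    refine (hy (A (S (B y) - z)) ⟨_, hm, rfl⟩).trans ?_
    rw [map_sub, h1, sub_sub_cancel]
    exact A.le_opNorm z
  have h3 : ‖M.mkQ (S (B y))‖ ≤ ‖M.mkQL ∘L S‖ * ‖B y‖ := (M.mkQL ∘L S).le_opNorm (B y)
  have h4 : ‖B y‖ ≤ ‖B‖ * ‖y‖ := B.le_opNorm y
  calc r * ‖y‖ ≤ ‖A‖ * (‖M.mkQL ∘L S‖ * (‖B‖ * ‖y‖) + δ / ‖A‖) := by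
        refine h2.trans ?_
        gcongr
        refine hlt.le.trans ?_
        gcongr
        exact h3.trans (by gcongr)
    _ = _ := by field_simp

theorem gelfandNumber_le_approximationNumber (n : ℕ) (S : X →L[ℝ] X) :
    gelfandNumber n S ≤ approximationNumber n S := by
  refine le_iInf fun P => le_iInf fun hP => ?_
  refine iInf_le_of_le (LinearMap.ker (P : X →ₗ[ℝ] X)) (iInf_le_of_le P.isClosed_ker
    (iInf_le_of_le ?_ ?_))
  · rwa [(LinearMap.quotKerEquivRange (P : X →ₗ[ℝ] X)).rank_eq]
  · rw [← ofReal_norm, ← ofReal_norm]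
    refine ENNReal.ofReal_le_ofReal (ContinuousLinearMap.opNorm_le_bound _ (norm_nonneg _) ?_)
    rintro ⟨x, hx⟩
    have hx' : P x = 0 := hx
    simpa [hx'] using (S - P).le_opNorm x

theorem kolmogorovNumber_le_approximationNumber (n : ℕ) (S : X →L[ℝ] X) :
    kolmogorovNumber n S ≤ approximationNumber n S := by
  refine le_iInf fun P => le_iInf fun hP => ?_
  have hfin : FiniteDimensional ℝ (LinearMap.range (P : X →ₗ[ℝ] X)) :=
    Module.rank_lt_aleph0_iff.1 (hP.trans (Cardinal.natCast_lt_aleph0))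
  refine iInf_le_of_le (LinearMap.range (P : X →ₗ[ℝ] X)) (iInf_le_of_le
    (Submodule.closed_of_finiteDimensional _) (iInf_le_of_le hP ?_))
  rw [← ofReal_norm, ← ofReal_norm]
  refine ENNReal.ofReal_le_ofReal (ContinuousLinearMap.opNorm_le_bound _ (norm_nonneg _) ?_)
  intro x
  refine le_trans ?_ ((S - P).le_opNorm x)
  have : (LinearMap.range (P : X →ₗ[ℝ] X)).mkQ (S x)
      = (LinearMap.range (P : X →ₗ[ℝ] X)).mkQ ((S - P) x) := by
    rw [← sub_eq_zero, ← map_sub]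
    simp
  change ‖(LinearMap.range (P : X →ₗ[ℝ] X)).mkQ (S x)‖ ≤ _
  rw [this]
  exact Submodule.Quotient.norm_mk_le _ _

/-- An operator `P` of rank below `n ≤ dim M` kills some `x ≠ 0` in `M`, and there `ρ ‖x‖ ≤ ‖S x‖ =
‖(S - P) x‖`. -/
theorem bernsteinNumber_le_approximationNumber (n : ℕ) (S : X →L[ℝ] X) :
    bernsteinNumber n S ≤ approximationNumber n S := by
  refine iSup_le fun M => iSup_le fun _ => iSup_le fun hM => iSup_le fun ρ => iSup_le fun hρ => ?_
  refine le_iInf fun P => le_iInf fun hP => ?_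
  obtain ⟨x, hx, hx0⟩ := exists_ne_zero_mem_ker_of_rank_lt ((P : X →ₗ[ℝ] X) ∘ₗ M.subtype)
    (((LinearMap.rank_comp_le_left _ _).trans_lt hP).trans_le hM)
  have hx0' : P x = 0 := by simpa using hx0
  have h1 := (hρ x).trans (by simpa [hx0'] using (S - P).le_opNorm (x : X))
  have h2 : (ρ : ℝ) ≤ ‖S - P‖ := le_of_mul_le_mul_right h1 (norm_pos_iff.2 hx)
  rw [← ofReal_norm, ← ENNReal.ofReal_coe_nnreal]
  exact ENNReal.ofReal_le_ofReal h2

theorem isomorphismNumber_le_sNumber (k : SNumberKind) {n : ℕ} (hn : 0 < n) (S : X →L[ℝ] X) :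
    isomorphismNumber n S ≤ sNumber k n S := by
  cases k with
  | approximation =>
    exact (isomorphismNumber_le_gelfandNumber n S).trans (gelfandNumber_le_approximationNumber n S)
  | isomorphism => exact le_rfl
  | gelfand => exact isomorphismNumber_le_gelfandNumber n S
  | kolmogorov => exact isomorphismNumber_le_kolmogorovNumber n S
  | bernstein => exact isomorphismNumber_le_bernsteinNumber hn S

theorem sNumber_le_approximationNumber (k : SNumberKind) (n : ℕ) (S : X →L[ℝ] X) :
    sNumber k n S ≤ approximationNumber n S := by
  cases k with
  | approximation => exact le_rfl
  | isomorphism =>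
    exact (isomorphismNumber_le_gelfandNumber n S).trans (gelfandNumber_le_approximationNumber n S)
  | gelfand => exact gelfandNumber_le_approximationNumber n S
  | kolmogorov => exact kolmogorovNumber_le_approximationNumber n S
  | bernstein => exact bernsteinNumber_le_approximationNumber n S

/-- Biorthogonal systems bound the isomorphism numbers from below. -/
theorem le_isomorphismNumber {ι : Type u} [Fintype ι] (S : X →L[ℝ] X) (f : ι → X)
    (g : ι → StrongDual ℝ X) (hfg : ∀ i, g i (S (f i)) = 1)
    (hfg' : ∀ i j, i ≠ j → g i (S (f j)) = 0) {K : ℝ} (hK : 0 < K)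
    (hbound : ∀ x, ‖∑ i, g i x • f i‖ ≤ K * ‖x‖) :
    ENNReal.ofReal K⁻¹ ≤ isomorphismNumber (Fintype.card ι) S := by
  classical
  -- Applying `g i ∘ S` to a linear relation among the `f j` isolates the `i`th coefficient.
  have hli : LinearIndependent ℝ f := by
    rw [Fintype.linearIndependent_iff]
    intro c hc i
    have := congrArg (fun x => g i (S x)) hc
    simp only [map_sum, map_smul, map_zero] at this
    rw [Finset.sum_eq_single i (fun j _ hj => by rw [hfg' i j hj.symm, smul_zero]) (by simp)] at this
    simpa [hfg] using this
  let G := Submodule.span ℝ (Set.range f)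
  have hfin : FiniteDimensional ℝ G := FiniteDimensional.span_of_finite ℝ (Set.finite_range f)
  have hcomplete : CompleteSpace G := FiniteDimensional.complete ℝ G
  have hrank : ((Fintype.card ι : ℕ) : Cardinal) ≤ Module.rank ℝ G := by
    rw [rank_span hli, Cardinal.mk_range_eq f hli.injective, Cardinal.mk_fintype]
  -- As `A₀ ∘ S` fixes every `f j`, the factorisation of the identity uses the span of `f`, the
  -- inclusion as `B` and `A₀` as `A`.
  let A₀ : X →L[ℝ] X := ∑ i, (g i).smulRight (f i)
  have hA₀ : ∀ x, A₀ x = ∑ i, g i x • f i := fun x => by simp [A₀]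
  have hmem : ∀ x, A₀ x ∈ G := fun x => by
    rw [hA₀]
    exact Submodule.sum_mem _ fun i _ => Submodule.smul_mem _ _
      (Submodule.subset_span (Set.mem_range_self i))
  let A : X →L[ℝ] G := A₀.codRestrict G hmem
  have hA : ‖A‖ ≤ K := by
    refine ContinuousLinearMap.opNorm_le_bound _ hK.le fun x => ?_
    change ‖A₀ x‖ ≤ _
    rw [hA₀]
    exact hbound x
  have hB : ‖G.subtypeL‖ ≤ 1 := G.norm_subtypeL_le
  have hid : A ∘L S ∘L G.subtypeL = ContinuousLinearMap.id ℝ G := by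
    ext ⟨x, hx⟩
    change A₀ (S x) = x
    have : Set.EqOn (A₀ ∘L S) (ContinuousLinearMap.id ℝ X) (Set.range f) := by
      rintro _ ⟨j, rfl⟩
      change A₀ (S (f j)) = f j
      rw [hA₀, Finset.sum_eq_single j (fun i _ hi => by rw [hfg' i j hi, zero_smul]) (by simp),
        hfg, one_smul]
    exact LinearMap.eqOn_span (f := ((A₀ ∘L S : X →L[ℝ] X) : X →ₗ[ℝ] X))
      (g := ((ContinuousLinearMap.id ℝ X : X →L[ℝ] X) : X →ₗ[ℝ] X)) this hx
  have hval : ENNReal.ofReal K⁻¹ ≤ ‖A‖ₑ⁻¹ * ‖G.subtypeL‖ₑ⁻¹ := by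
    rw [ENNReal.ofReal_inv_of_pos hK, ← mul_one (ENNReal.ofReal K)⁻¹]
    refine mul_le_mul' (ENNReal.inv_le_inv.2 ?_) ?_
    · rw [← ofReal_norm]
      exact ENNReal.ofReal_le_ofReal hA
    · rw [← inv_one]
      refine ENNReal.inv_le_inv.2 ?_
      rw [← ofReal_norm, ← ENNReal.ofReal_one]
      exact ENNReal.ofReal_le_ofReal hB
  exact hval.trans (le_iSup_of_le G (le_iSup_of_le _ (le_iSup_of_le _ (le_iSup_of_le hcomplete
    (le_iSup_of_le hrank (le_iSup_of_le A (le_iSup_of_le G.subtypeL (le_iSup_of_le hid le_rfl))))))))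

end SNumberComparison

/-! ### Monotone function norms, absolute continuity, continuous approximation -/

/-- A (possibly infinite) monotone function norm. -/
structure LatticeNorm (μ : Measure ℝ) where
  ρ : (ℝ → ℝ) → ℝ≥0∞
  add_le : ∀ f g : ℝ → ℝ, AEStronglyMeasurable f μ → AEStronglyMeasurable g μ →
    ρ (f + g) ≤ ρ f + ρ g
  smul : ∀ (c : ℝ) (f : ℝ → ℝ), AEStronglyMeasurable f μ → ρ (c • f) = ‖c‖ₑ * ρ f
  mono : ∀ f g : ℝ → ℝ, AEStronglyMeasurable f μ → AEStronglyMeasurable g μ →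
    (∀ᵐ x ∂μ, |f x| ≤ |g x|) → ρ f ≤ ρ g
  one_lt_top : ρ (fun _ => 1) < ⊤

namespace LatticeNorm

variable {μ : Measure ℝ} (L : LatticeNorm μ) {f g h : ℝ → ℝ}

/-- The functions of finite norm. -/
def Mem (f : ℝ → ℝ) : Prop := AEStronglyMeasurable f μ ∧ L.ρ f < ⊤

/-- The norm as a real number. -/
noncomputable def nrm (f : ℝ → ℝ) : ℝ := (L.ρ f).toReal

theorem nrm_nonneg (f : ℝ → ℝ) : 0 ≤ L.nrm f := ENNReal.toReal_nonneg

variable {L}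

theorem Mem.of_abs_le (hg : L.Mem g) (hf : AEStronglyMeasurable f μ)
    (h : ∀ᵐ x ∂μ, |f x| ≤ |g x|) : L.Mem f :=
  ⟨hf, (L.mono f g hf hg.1 h).trans_lt hg.2⟩

theorem Mem.nrm_le (hg : L.Mem g) (hf : AEStronglyMeasurable f μ)
    (h : ∀ᵐ x ∂μ, |f x| ≤ |g x|) : L.nrm f ≤ L.nrm g :=
  ENNReal.toReal_mono hg.2.ne (L.mono f g hf hg.1 h)

theorem ρ_congr (hg : AEStronglyMeasurable g μ) (h : f =ᵐ[μ] g) : L.ρ f = L.ρ g :=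
  le_antisymm (L.mono _ _ (hg.congr h.symm) hg (h.mono fun x hx => by rw [hx]))
    (L.mono _ _ hg (hg.congr h.symm) (h.mono fun x hx => by rw [hx]))

theorem nrm_congr (hg : AEStronglyMeasurable g μ) (h : f =ᵐ[μ] g) : L.nrm f = L.nrm g :=
  congrArg ENNReal.toReal (ρ_congr hg h)

theorem Mem.add (hf : L.Mem f) (hg : L.Mem g) : L.Mem (f + g) :=
  ⟨hf.1.add hg.1, (L.add_le f g hf.1 hg.1).trans_lt (ENNReal.add_lt_top.2 ⟨hf.2, hg.2⟩)⟩

theorem Mem.smul (c : ℝ) (hf : L.Mem f) : L.Mem (c • f) :=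
  ⟨hf.1.const_smul c, by rw [L.smul c f hf.1]; exact ENNReal.mul_lt_top enorm_lt_top hf.2⟩

theorem nrm_smul (c : ℝ) (hf : AEStronglyMeasurable f μ) : L.nrm (c • f) = |c| * L.nrm f := by
  rw [nrm, nrm, L.smul c f hf, ENNReal.toReal_mul]
  simp

theorem Mem.abs (hf : L.Mem f) : L.Mem (fun x => |f x|) :=
  hf.of_abs_le hf.1.norm (by simp)

theorem Mem.nrm_abs (hf : L.Mem f) : L.nrm (fun x => |f x|) = L.nrm f :=
  le_antisymm (hf.nrm_le hf.1.norm (by simp)) (hf.abs.nrm_le hf.1 (by simp))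

theorem Mem.nrm_add_le (hf : L.Mem f) (hg : L.Mem g) : L.nrm (f + g) ≤ L.nrm f + L.nrm g := by
  rw [nrm, nrm, nrm, ← ENNReal.toReal_add hf.2.ne hg.2.ne]
  exact ENNReal.toReal_mono (ENNReal.add_lt_top.2 ⟨hf.2, hg.2⟩).ne (L.add_le f g hf.1 hg.1)

theorem Mem.nrm_le_add (hg : L.Mem g) (hh : L.Mem h) (hf : AEStronglyMeasurable f μ)
    (H : ∀ᵐ x ∂μ, |f x| ≤ |g x| + |h x|) : L.nrm f ≤ L.nrm g + L.nrm h := by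
  rw [← hg.nrm_abs, ← hh.nrm_abs]
  refine le_trans ((hg.abs.add hh.abs).nrm_le hf (H.mono fun x hx => ?_))
    (hg.abs.nrm_add_le hh.abs)
  exact hx.trans (le_abs_self _)

theorem Mem.neg (hf : L.Mem f) : L.Mem (-f) := hf.of_abs_le hf.1.neg (by simp)

theorem Mem.sub (hf : L.Mem f) (hg : L.Mem g) : L.Mem (f - g) := by
  rw [sub_eq_add_neg]
  exact hf.add hg.neg

theorem Mem.indicator (hf : L.Mem f) {S : Set ℝ} (hS : MeasurableSet S) : L.Mem (S.indicator f) :=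
  hf.of_abs_le (hf.1.indicator hS) (.of_forall fun x => by
    by_cases hx : x ∈ S <;> simp [hx])

theorem Mem.nrm_indicator_le (hf : L.Mem f) {S : Set ℝ} (hS : MeasurableSet S) :
    L.nrm (S.indicator f) ≤ L.nrm f :=
  hf.nrm_le (hf.1.indicator hS) (.of_forall fun x => by
    by_cases hx : x ∈ S <;> simp [hx])

theorem Mem.nrm_indicator_mono (hf : L.Mem f) {S T : Set ℝ} (hS : MeasurableSet S)
    (hT : MeasurableSet T) (hST : S ⊆ T) :
    L.nrm (S.indicator f) ≤ L.nrm (T.indicator f) :=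
  (hf.indicator hT).nrm_le (hf.1.indicator hS) (.of_forall fun x => by
    by_cases hx : x ∈ S
    · simp [hx, hST hx]
    · simp [hx])

theorem mem_one : L.Mem (fun _ => 1) := ⟨aestronglyMeasurable_const, L.one_lt_top⟩

theorem mem_const (c : ℝ) : L.Mem (fun _ => c) := by
  have : (fun _ : ℝ => c) = c • (fun _ : ℝ => (1 : ℝ)) := by ext; simp
  rw [this]
  exact mem_one.smul c

theorem nrm_zero : L.nrm (fun _ => 0) = 0 := by
  have := nrm_smul (L := L) (f := fun _ => 0) 0 aestronglyMeasurable_const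
  simpa only [Pi.smul_def, smul_zero, abs_zero, zero_mul] using this

theorem mem_of_bounded (hf : AEStronglyMeasurable f μ) {M : ℝ} (h : ∀ᵐ x ∂μ, |f x| ≤ M) :
    L.Mem f :=
  (mem_const M).of_abs_le hf (h.mono fun _ hx => hx.trans (le_abs_self M))

theorem Mem.sum {ι : Type*} {s : Finset ι} {F : ι → ℝ → ℝ} (h : ∀ i ∈ s, L.Mem (F i)) :
    L.Mem (∑ i ∈ s, F i) := by
  classical
  induction s using Finset.induction_on with
  | empty =>
    rw [Finset.sum_empty]
    exact mem_const 0
  | insert i s hi ih =>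
    rw [Finset.sum_insert hi]
    exact (h i (Finset.mem_insert_self i s)).add
      (ih fun j hj => h j (Finset.mem_insert_of_mem hj))

variable {a b : ℝ} {K : LatticeNorm (lebesgueOn a b)}

/-- Otherwise there are sets `X n` of measure at most `2⁻ⁿ` violating the bound. By Borel–Cantelli
almost every point lies in finitely many of them, so absolute continuity applies to this sequence.
-/
theorem Mem.uniform_ac (hK : BanachFunctionSpace.IsACNorm a b K.Mem K.ρ) (hf : K.Mem f) {ε : ℝ}
    (hε : 0 < ε) : ∃ η > 0, ∀ X : Set ℝ, MeasurableSet X → X ⊆ Ioo a b →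
      volume X ≤ ENNReal.ofReal η → K.nrm (X.indicator f) ≤ ε := by
  by_contra! hc
  have hpos : ∀ n : ℕ, (0 : ℝ) < (1 / 2) ^ n := fun n => by positivity
  choose X hX hXI hvol hlarge using fun n : ℕ => hc ((1 / 2) ^ n) (hpos n)
  have hsum : ∑' n, volume (X n) ≠ ⊤ := by
    refine ne_top_of_le_ne_top ?_ (ENNReal.tsum_le_tsum hvol)
    rw [← ENNReal.ofReal_tsum_of_nonneg (fun n => (hpos n).le) summable_geometric_two]
    exact ENNReal.ofReal_ne_top
  have h0 : Tendsto (fun n => K.ρ ((X n).indicator f)) atTop (𝓝 0) := by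
    refine hK f hf X (fun n => ⟨hX n, hXI n⟩) (ae_restrict_of_ae ?_)
    filter_upwards [ae_eventually_notMem hsum] with x hx
    refine tendsto_const_nhds.congr' (hx.mono fun n hn => ?_)
    simp [hn]
  have h1 : Tendsto (fun n => K.nrm ((X n).indicator f)) atTop (𝓝 0) :=
    (ENNReal.tendsto_toReal ENNReal.zero_ne_top).comp h0
  obtain ⟨n, hn⟩ := (h1.eventually (gt_mem_nhds hε)).exists
  exact absurd hn (hlarge n).not_gt

theorem Mem.exists_truncation (hK : BanachFunctionSpace.IsACNorm a b K.Mem K.ρ) (hf : K.Mem f)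
    (hf0 : ∀ᵐ x ∂lebesgueOn a b, 0 ≤ f x) {δ : ℝ} (hδ : 0 < δ) :
    ∃ (M : ℝ) (h : ℝ → ℝ), Measurable h ∧ (∀ x, 0 ≤ h x ∧ h x ≤ M) ∧ K.nrm (f - h) ≤ δ := by
  obtain ⟨f₀, hf₀, hff₀⟩ := hf.1
  let X : ℕ → Set ℝ := fun n => {x | (n : ℝ) < f₀ x} ∩ Ioo a b
  have hX : ∀ n, MeasurableSet (X n) := fun n =>
    (measurableSet_lt measurable_const hf₀.measurable).inter measurableSet_Ioo
  have h0 : Tendsto (fun n => K.ρ ((X n).indicator f)) atTop (𝓝 0) := by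
    refine hK f hf X (fun n => ⟨hX n, inter_subset_right⟩) (.of_forall fun x => ?_)
    refine tendsto_const_nhds.congr' ?_
    obtain ⟨N, hN⟩ := exists_nat_ge (f₀ x)
    filter_upwards [eventually_ge_atTop N] with n hn
    have : x ∉ X n := fun hx => absurd hx.1 (not_lt.2 (hN.trans (by exact_mod_cast hn)))
    simp [this]
  have h1 : Tendsto (fun n => K.nrm ((X n).indicator f)) atTop (𝓝 0) :=
    (ENNReal.tendsto_toReal ENNReal.zero_ne_top).comp h0
  obtain ⟨n, hn⟩ := (h1.eventually (gt_mem_nhds hδ)).exists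
  have hmeas : Measurable fun x => max 0 (min (f₀ x) n) :=
    measurable_const.max (hf₀.measurable.min measurable_const)
  refine ⟨n, fun x => max 0 (min (f₀ x) n), hmeas, fun x => ⟨le_max_left _ _, ?_⟩, ?_⟩
  · exact max_le n.cast_nonneg (min_le_right _ _)
  · refine ((hf.indicator (hX n)).nrm_le (hf.1.sub hmeas.aestronglyMeasurable) ?_).trans hn.le
    filter_upwards [hff₀, hf0, ae_restrict_mem measurableSet_Ioo] with x hx hx0 hxI
    have hn0 : (0 : ℝ) ≤ n := n.cast_nonneg
    rw [Pi.sub_apply, ← hx]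
    by_cases hxX : (n : ℝ) < f x
    · rw [indicator_of_mem (show x ∈ X n from ⟨by simpa [← hx] using hxX, hxI⟩),
        min_eq_right hxX.le, max_eq_right hn0, abs_of_nonneg (sub_nonneg.2 hxX.le),
        abs_of_nonneg hx0]
      linarith
    · rw [min_eq_left (not_lt.1 hxX), max_eq_right hx0, sub_self, abs_zero]
      exact abs_nonneg _

/-- An `L¹`-approximation is clipped to `[0, M]`. Where it errs by less than `τ` the constant `τ`
dominates the error; elsewhere the error is at most `M` on a set that Markov's inequality makes
small, and absolute continuity of the norm of the constant `M` applies. -/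
theorem exists_continuous_of_bounded (hK : BanachFunctionSpace.IsACNorm a b K.Mem K.ρ) {M : ℝ}
    (hh : Measurable h) (hM : ∀ x, 0 ≤ h x ∧ h x ≤ M) {δ : ℝ} (hδ : 0 < δ) :
    ∃ g : ℝ → ℝ, Continuous g ∧ (∀ x, 0 ≤ g x ∧ g x ≤ M) ∧ K.nrm (h - g) ≤ δ := by
  have hM0 : 0 ≤ M := (hM 0).1.trans (hM 0).2
  obtain ⟨η, hη, hηX⟩ := (mem_const (L := K) M).uniform_ac hK (half_pos hδ)
  set τ := δ / 2 / (K.nrm (fun _ => 1) + 1) with hτ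
  have hτ0 : 0 < τ := by have := K.nrm_nonneg (fun _ => 1); positivity
  have hτ1 : τ * K.nrm (fun _ => 1) ≤ δ / 2 := by
    have := K.nrm_nonneg (fun _ => 1)
    rw [hτ, div_mul_eq_mul_div, div_le_iff₀ (by positivity)]
    nlinarith
  have hint : Integrable h (lebesgueOn a b) := by
    refine (integrable_const M).mono' hh.aestronglyMeasurable (.of_forall fun x => ?_)
    rw [Real.norm_eq_abs, abs_of_nonneg (hM x).1]
    exact (hM x).2
  -- With `L¹`-error at most `τ * η`, the set where the error is at least `τ` has measure at most
  -- `η`.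
  obtain ⟨g₁, hg₁, hg₁i⟩ := hint.exists_boundedContinuous_integral_sub_le (mul_pos hτ0 hη)
  let g : ℝ → ℝ := fun x => max 0 (min (g₁ x) M)
  have hgc : Continuous g := continuous_const.max (g₁.continuous.min continuous_const)
  have hgM : ∀ x, 0 ≤ g x ∧ g x ≤ M := fun x =>
    ⟨le_max_left _ _, max_le hM0 (min_le_right _ _)⟩
  refine ⟨g, hgc, hgM, ?_⟩
  have hclose : ∀ x, |h x - g x| ≤ |h x - g₁ x| := by
    intro x
    have h1 := hM x
    simp only [g]
    rcases le_total (g₁ x) M with h2 | h2 <;> rcases le_total 0 (g₁ x) with h3 | h3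
    · rw [min_eq_left h2, max_eq_right h3]
    · rw [min_eq_left h2, max_eq_left h3, abs_of_nonneg (by linarith), abs_of_nonneg (by linarith)]
      linarith
    · rw [min_eq_right h2, max_eq_right hM0, abs_of_nonpos (by linarith),
        abs_of_nonpos (by linarith)]
      linarith
    · rw [min_eq_right h2, max_eq_right hM0, abs_of_nonpos (by linarith),
        abs_of_nonpos (by linarith)]
      linarith
  let X : Set ℝ := {x | τ ≤ |h x - g₁ x|} ∩ Ioo a b
  have hXm : MeasurableSet X := (measurableSet_le measurable_const
    (hh.sub g₁.continuous.measurable).abs).inter measurableSet_Ioo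
  have hXv : volume X ≤ ENNReal.ofReal η := by
    have h1 := mul_meas_ge_le_integral_of_nonneg (μ := lebesgueOn a b)
      (f := fun x => |h x - g₁ x|) (.of_forall fun x => abs_nonneg _) (hint.sub hg₁i).abs τ
    have h2 : (lebesgueOn a b).real {x | τ ≤ |h x - g₁ x|} ≤ η :=
      le_of_mul_le_mul_left (h1.trans hg₁) hτ0
    have h3 : (lebesgueOn a b) {x | τ ≤ |h x - g₁ x|} = volume X :=
      Measure.restrict_apply (measurableSet_le measurable_const
        (hh.sub g₁.continuous.measurable).abs)
    rw [← h3, ← ENNReal.ofReal_toReal (measure_ne_top (lebesgueOn a b) _)]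
    exact ENNReal.ofReal_le_ofReal h2
  have h1 := hηX X hXm inter_subset_right hXv
  have h2 : K.nrm (h - g) ≤ K.nrm (τ • fun _ => 1) + K.nrm (X.indicator fun _ => M) := by
    refine (mem_one.smul τ).nrm_le_add ((mem_const M).indicator hXm)
      (hh.aestronglyMeasurable.sub hgc.aestronglyMeasurable) ?_
    filter_upwards [ae_restrict_mem measurableSet_Ioo] with x hxI
    by_cases hx : x ∈ X
    · have h3 : |h x - g x| ≤ M := by
        rw [abs_le]
        constructor <;> linarith [hM x, hgM x, (hM x).1, (hgM x).1, (hM x).2, (hgM x).2]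
      rw [indicator_of_mem hx]
      exact (h3.trans (le_abs_self M)).trans (le_add_of_nonneg_left (abs_nonneg _))
    · have h3 : |h x - g₁ x| < τ := by
        by_contra hcon
        exact hx ⟨not_lt.1 hcon, hxI⟩
      rw [indicator_of_notMem hx]
      simpa [abs_of_pos hτ0] using (hclose x).trans h3.le
  rw [nrm_smul _ aestronglyMeasurable_const, abs_of_pos hτ0] at h2
  linarith

theorem Mem.exists_continuous_approx (hK : BanachFunctionSpace.IsACNorm a b K.Mem K.ρ)
    (hf : K.Mem f) (hf0 : ∀ᵐ x ∂lebesgueOn a b, 0 < f x) {δ : ℝ} (hδ : 0 < δ) :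
    ∃ g : ℝ → ℝ, Continuous g ∧ (∃ θ > 0, ∀ x, θ ≤ g x) ∧ K.Mem g ∧ K.nrm (f - g) ≤ δ := by
  obtain ⟨M, h, hh, hM, hfh⟩ := hf.exists_truncation hK (hf0.mono fun x hx => hx.le)
    (show 0 < δ / 4 by positivity)
  obtain ⟨g, hg, hgM, hhg⟩ := exists_continuous_of_bounded hK hh hM (show 0 < δ / 4 by positivity)
  -- Adding the constant `θ` bounds the approximant away from zero and costs at most `δ / 2`; the
  -- truncation and the continuous approximation cost `δ / 4` each.
  set θ := δ / 2 / (K.nrm (fun _ => 1) + 1) with hθ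
  have hθ0 : 0 < θ := by have := K.nrm_nonneg (fun _ => 1); positivity
  have hθ1 : θ * K.nrm (fun _ => 1) ≤ δ / 2 := by
    have := K.nrm_nonneg (fun _ => 1)
    rw [hθ, div_mul_eq_mul_div, div_le_iff₀ (by positivity)]
    nlinarith
  have hhm : K.Mem h := mem_of_bounded hh.aestronglyMeasurable
    (.of_forall fun x => by rw [abs_of_nonneg (hM x).1]; exact (hM x).2)
  have hgm : K.Mem g := mem_of_bounded hg.aestronglyMeasurable
    (.of_forall fun x => by rw [abs_of_nonneg (hgM x).1]; exact (hgM x).2)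
  refine ⟨g + θ • fun _ => 1, hg.add (continuous_const.const_smul θ), ⟨θ, hθ0, fun x => ?_⟩,
    hgm.add (mem_one.smul θ), ?_⟩
  · simpa using (hgM x).1
  · have h1 : f - (g + θ • fun _ => 1) = (f - h) + ((h - g) + (-θ) • fun _ => 1) := by
      ext x
      simp
      ring
    rw [h1]
    refine ((hf.sub hhm).nrm_add_le ((hhm.sub hgm).add (mem_one.smul _))).trans ?_
    have h2 := (hhm.sub hgm).nrm_add_le (mem_one.smul (-θ))
    rw [nrm_smul _ aestronglyMeasurable_const, abs_neg, abs_of_pos hθ0] at h2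
    linarith

end LatticeNorm

/-! ### The associate norm, Hölder's inequality and nearly norming functions -/

namespace BanachFunctionSpace

variable {a b : ℝ} (E : BanachFunctionSpace a b) {f g : ℝ → ℝ}

/-- The norm of `E` as a function norm. -/
def lat : LatticeNorm (lebesgueOn a b) where
  ρ := E.fnorm
  add_le := E.fnorm_add_le
  smul := E.fnorm_smul
  mono f g hf hg h := by
    rw [← E.fnorm_abs f hf, ← E.fnorm_abs g hg]
    exact E.fnorm_mono _ _ hf.norm hg.norm (h.mono fun x hx => ⟨abs_nonneg _, hx⟩)
  one_lt_top := E.bounded_mem _ (memLp_const 1)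

theorem fnorm_sum_le (F : ℕ → ℝ → ℝ) (hF : ∀ k, AEStronglyMeasurable (F k) (lebesgueOn a b))
    (n : ℕ) : E.fnorm (∑ k ∈ Finset.range n, F k) ≤ ∑ k ∈ Finset.range n, E.fnorm (F k) := by
  induction n with
  | zero =>
    simp only [Finset.range_zero, Finset.sum_empty, nonpos_iff_eq_zero]
    exact (E.fnorm_eq_zero_iff _ aestronglyMeasurable_const).2 (.refl _ _)
  | succ n ih =>
    rw [Finset.sum_range_succ, Finset.sum_range_succ]
    refine (E.fnorm_add_le _ _ (Finset.aestronglyMeasurable_sum _ fun k _ => hF k) (hF n)).trans ?_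
    gcongr

/-- A series of nonnegative functions with summable norms has a majorant in the space. -/
theorem exists_mem_ge_of_tsum (F : ℕ → ℝ → ℝ) (hF : ∀ k, Measurable (F k))
    (hF0 : ∀ k x, 0 ≤ F k x) (hS : ∑' k, E.fnorm (F k) ≠ ⊤) :
    ∃ G, E.Mem G ∧ ∀ᵐ x ∂lebesgueOn a b, ∀ k, F k x ≤ G x := by
  set S := ∑' k, E.fnorm (F k) with hSdef
  -- The sum may be infinite at some points, whereas the norm is defined on real functions. Hence
  -- everything is truncated at height `N`; the Fatou property is used as the number of terms grows,
  -- and again as `N` grows.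
  let H : ℝ → ℝ≥0∞ := fun x => ∑' k, ENNReal.ofReal (F k x)
  have hH : Measurable H := Measurable.tsum fun k => (hF k).ennreal_ofReal
  let P : ℕ → ℕ → ℝ → ℝ := fun N n x =>
    (min (∑ k ∈ Finset.range n, ENNReal.ofReal (F k x)) N).toReal
  let G : ℕ → ℝ → ℝ := fun N x => (min (H x) N).toReal
  have hPm : ∀ N n, Measurable (P N n) := fun N n =>
    ((Finset.measurable_sum _ fun k _ => (hF k).ennreal_ofReal).min
      measurable_const).ennreal_toReal
  have hGm : ∀ N, Measurable (G N) := fun N => (hH.min measurable_const).ennreal_toReal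
  have hmin : ∀ (y : ℝ≥0∞) (N : ℕ), min y N ≠ ⊤ := fun y N =>
    ne_top_of_le_ne_top (ENNReal.natCast_ne_top N) (min_le_right _ _)
  have hP : ∀ N n, E.fnorm (P N n) ≤ S := by
    intro N n
    refine le_trans (E.fnorm_mono _ (∑ k ∈ Finset.range n, F k) (hPm N n).aestronglyMeasurable
      (Finset.aestronglyMeasurable_sum _ fun k _ => (hF k).aestronglyMeasurable)
      (.of_forall fun x => ⟨ENNReal.toReal_nonneg, ?_⟩))
      ((E.fnorm_sum_le F (fun k => (hF k).aestronglyMeasurable) n).trans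
        (ENNReal.sum_le_tsum _))
    rw [Finset.sum_apply]
    refine ENNReal.toReal_le_of_le_ofReal (Finset.sum_nonneg fun k _ => hF0 k x) ?_
    rw [ENNReal.ofReal_sum_of_nonneg fun k _ => hF0 k x]
    exact min_le_left _ _
  have hG : ∀ N, E.fnorm (G N) ≤ S := by
    intro N
    refine le_of_tendsto (E.fnorm_fatou (P N) (G N) (fun n => (hPm N n).aestronglyMeasurable)
      (hGm N).aestronglyMeasurable (.of_forall fun x => ⟨fun n => ENNReal.toReal_nonneg, ?_, ?_⟩))
      (.of_forall (hP N))
    · intro m n hmn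
      refine ENNReal.toReal_mono (hmin _ N) (min_le_min_right _ ?_)
      exact Finset.sum_le_sum_of_subset (Finset.range_mono hmn)
    · refine (ENNReal.tendsto_toReal (hmin _ N)).comp ?_
      exact (ENNReal.tendsto_nat_tsum fun k => ENNReal.ofReal (F k x)).min tendsto_const_nhds
  let X : Set ℝ := {x | H x = ⊤}
  have hX : MeasurableSet X := hH (measurableSet_singleton ⊤)
  have hone : AEStronglyMeasurable (X.indicator fun _ => (1 : ℝ)) (lebesgueOn a b) :=
    aestronglyMeasurable_const.indicator hX
  -- On `X` the truncation `G N` equals `N`, so `N ‖χ_X‖ ≤ S` for every `N`, and the sum is finite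
  -- almost everywhere.
  have hX0 : E.fnorm (X.indicator fun _ => 1) = 0 := by
    by_contra hne
    have hle : ∀ N : ℕ, (N : ℝ≥0∞) * E.fnorm (X.indicator fun _ => 1) ≤ S := by
      intro N
      have h1 := E.fnorm_smul (N : ℝ) _ hone
      have h2 : ‖(N : ℝ)‖ₑ = N := by simp
      rw [h2] at h1
      rw [← h1]
      refine (E.fnorm_mono _ _ (hone.const_smul _) (hGm N).aestronglyMeasurable
        (.of_forall fun x => ?_)).trans (hG N)
      by_cases hx : x ∈ X
      · have hx' : H x = ⊤ := hx
        simp [hx, G, hx']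
      · have : 0 ≤ G N x := ENNReal.toReal_nonneg
        simpa [hx] using this
    obtain ⟨N, hN⟩ := ENNReal.exists_nat_mul_gt hne hS
    exact absurd (hle N) hN.not_ge
  have hae : ∀ᵐ x ∂lebesgueOn a b, H x ≠ ⊤ := by
    filter_upwards [(E.fnorm_eq_zero_iff _ hone).1 hX0] with x hx hx'
    rw [indicator_of_mem (show x ∈ X from hx')] at hx
    exact one_ne_zero hx
  refine ⟨fun x => (H x).toReal, ⟨hH.ennreal_toReal.aestronglyMeasurable, ?_⟩, ?_⟩
  · refine lt_of_le_of_lt (le_of_tendsto (E.fnorm_fatou G _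
      (fun n => (hGm n).aestronglyMeasurable) hH.ennreal_toReal.aestronglyMeasurable
      (hae.mono fun x hx => ⟨fun n => ENNReal.toReal_nonneg, ?_, ?_⟩)) (.of_forall hG)) hS.lt_top
    · intro m n hmn
      exact ENNReal.toReal_mono (hmin _ n) (min_le_min_left _ (by exact_mod_cast hmn))
    · refine (ENNReal.tendsto_toReal hx).comp ?_
      have := (tendsto_const_nhds (x := H x)).min ENNReal.tendsto_nat_nhds_top
      simpa using this
  · refine hae.mono fun x hx k => ?_
    rw [← ENNReal.ofReal_le_iff_le_toReal hx]
    exact ENNReal.le_tsum k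

/-- A uniform boundedness argument. If the supremum were infinite, choose `f k` in the unit ball
with `∫ |f k * g| > 4ᵏ`. The functions `2⁻ᵏ |f k|` have a common majorant `G` in `E`, and then `∫ |G
* g| ≥ 2ᵏ` for all `k`, contradicting the integrability of `G * g`. -/
theorem assocNorm_lt_top (hg : E.MemAssoc g) : E.assocNorm g < ⊤ := by
  rw [lt_top_iff_ne_top]
  intro htop
  have hex : ∀ k : ℕ, ∃ f : ℝ → ℝ, AEStronglyMeasurable f (lebesgueOn a b) ∧ E.fnorm f ≤ 1 ∧
      (4 : ℝ≥0∞) ^ k < ∫⁻ x, ‖f x * g x‖ₑ ∂(lebesgueOn a b) := by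
    intro k
    have h : (4 : ℝ≥0∞) ^ k < E.assocNorm g := by
      rw [htop]
      exact ENNReal.pow_lt_top (by simp)
    simp only [assocNorm, lt_iSup_iff] at h
    obtain ⟨f, h1, h2, h3⟩ := h
    exact ⟨f, h1, h2, h3⟩
  choose f hf hf1 hfg using hex
  let F : ℕ → ℝ → ℝ := fun k x => (1 / 2) ^ k * |(hf k).mk (f k) x|
  have hFm : ∀ k, Measurable (F k) := fun k =>
    ((hf k).stronglyMeasurable_mk.measurable.abs).const_mul _
  have hFn : ∀ k, E.fnorm (F k) ≤ ENNReal.ofReal ((1 / 2) ^ k) := by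
    intro k
    have h1 := E.fnorm_smul ((1 / 2) ^ k) (fun x => |(hf k).mk (f k) x|)
      ((hf k).stronglyMeasurable_mk.measurable.abs.aestronglyMeasurable)
    have h2 : F k = ((1 / 2 : ℝ) ^ k) • fun x => |(hf k).mk (f k) x| := rfl
    rw [h2, h1, E.fnorm_abs _ (hf k).stronglyMeasurable_mk.aestronglyMeasurable,
      ← E.fnorm_congr _ _ (hf k) (hf k).stronglyMeasurable_mk.aestronglyMeasurable
        (hf k).ae_eq_mk, Real.enorm_of_nonneg (by positivity)]
    exact mul_le_of_le_one_right' (hf1 k)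
  obtain ⟨G, hG, hFG⟩ := E.exists_mem_ge_of_tsum F hFm (fun k x => by positivity) (by
    refine ne_top_of_le_ne_top ?_ (ENNReal.tsum_le_tsum hFn)
    rw [← ENNReal.ofReal_tsum_of_nonneg (fun n => by positivity) summable_geometric_two]
    exact ENNReal.ofReal_ne_top)
  have hint := (hg.2 G hG).hasFiniteIntegral
  have hle : ∀ k : ℕ, (2 : ℝ≥0∞) ^ k ≤ ∫⁻ x, ‖G x * g x‖ₑ ∂(lebesgueOn a b) := by
    intro k
    have h2 : ENNReal.ofReal ((1 / 2) ^ k) * (4 : ℝ≥0∞) ^ k = 2 ^ k := by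
      rw [← ENNReal.ofReal_ofNat 4, ← ENNReal.ofReal_ofNat 2, ← ENNReal.ofReal_pow (by norm_num),
        ← ENNReal.ofReal_pow (by norm_num), ← ENNReal.ofReal_mul (by positivity), ← mul_pow]
      norm_num
    rw [← h2]
    refine (mul_le_mul_right (hfg k).le _).trans ?_
    rw [← lintegral_const_mul' _ _ ENNReal.ofReal_ne_top]
    refine lintegral_mono_ae ?_
    filter_upwards [hFG, (hf k).ae_eq_mk] with x hx hx'
    have h3 : ENNReal.ofReal ((1 / 2) ^ k) = ‖((1 / 2 : ℝ) ^ k)‖ₑ :=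
      (Real.enorm_of_nonneg (by positivity)).symm
    rw [h3, ← enorm_mul, ← mul_assoc, enorm_mul (_ * _), enorm_mul (G x)]
    gcongr
    refine enorm_le_iff_norm_le.2 ?_
    have h4 := hx k
    have h5 : F k x = ‖(1 / 2) ^ k * f k x‖ := by
      rw [norm_mul, Real.norm_of_nonneg (by positivity), Real.norm_eq_abs, hx']
    rw [← h5]
    exact h4.trans (le_abs_self _)
  obtain ⟨n, hn⟩ := ENNReal.exists_nat_gt hint.ne
  have h1 := (hle n).trans_lt hn
  have h2 : (n : ℝ≥0∞) < 2 ^ n := by exact_mod_cast n.lt_two_pow_self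
  exact absurd h1 h2.not_gt

theorem memAssoc_one : E.MemAssoc fun _ => 1 :=
  ⟨aestronglyMeasurable_const, fun f hf => by simpa using E.mem_integrable f hf.1 hf.2⟩

/-- The norm of the associate space as a function norm. -/
noncomputable def assocLat : LatticeNorm (lebesgueOn a b) where
  ρ := E.assocNorm
  add_le g h hg _ := by
    refine iSup_le fun f => iSup_le fun hf => iSup_le fun hf1 => ?_
    calc ∫⁻ x, ‖f x * (g + h) x‖ₑ ∂(lebesgueOn a b)
        ≤ ∫⁻ x, (‖f x * g x‖ₑ + ‖f x * h x‖ₑ) ∂(lebesgueOn a b) := by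
          refine lintegral_mono fun x => ?_
          rw [Pi.add_apply, mul_add]
          exact enorm_add_le _ _
      _ = ∫⁻ x, ‖f x * g x‖ₑ ∂(lebesgueOn a b) + ∫⁻ x, ‖f x * h x‖ₑ ∂(lebesgueOn a b) :=
          lintegral_add_left' (hf.mul hg).enorm _
      _ ≤ E.assocNorm g + E.assocNorm h :=
          add_le_add (le_iSup_of_le f (le_iSup_of_le hf (le_iSup_of_le hf1 le_rfl)))
            (le_iSup_of_le f (le_iSup_of_le hf (le_iSup_of_le hf1 le_rfl)))
  smul c g _ := by
    simp only [assocNorm, ENNReal.mul_iSup]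
    refine iSup_congr fun f => iSup_congr fun hf => iSup_congr fun hf1 => ?_
    rw [← lintegral_const_mul' _ _ enorm_ne_top]
    refine lintegral_congr fun x => ?_
    rw [← enorm_mul, Pi.smul_apply, smul_eq_mul]
    ring_nf
  mono g h _ _ hgh := by
    refine iSup_mono fun f => iSup_mono fun hf => iSup_mono fun hf1 => ?_
    refine lintegral_mono_ae (hgh.mono fun x hx => ?_)
    rw [enorm_mul, enorm_mul]
    gcongr
    exact enorm_le_iff_norm_le.2 hx
  one_lt_top := E.assocNorm_lt_top E.memAssoc_one

variable {E}

theorem lintegral_mul_le (hf : E.lat.Mem f) (g : ℝ → ℝ) :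
    ∫⁻ x, ‖f x * g x‖ₑ ∂(lebesgueOn a b) ≤ E.fnorm f * E.assocNorm g := by
  have hfin : E.fnorm f ≠ ⊤ := hf.2.ne
  by_cases h0 : E.fnorm f = 0
  · have h1 := (E.fnorm_eq_zero_iff f hf.1).1 h0
    rw [lintegral_congr_ae (g := fun _ => 0) (h1.mono fun x hx => by simp [hx])]
    simp
  · have hpos : 0 < (E.fnorm f).toReal := ENNReal.toReal_pos h0 hfin
    have hle : E.fnorm ((E.fnorm f).toReal⁻¹ • f) ≤ 1 := by
      rw [E.fnorm_smul _ f hf.1, Real.enorm_of_nonneg (by positivity),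
        ENNReal.ofReal_inv_of_pos hpos, ENNReal.ofReal_toReal hfin,
        ENNReal.inv_mul_cancel h0 hfin]
    have h1 : ∫⁻ x, ‖((E.fnorm f).toReal⁻¹ • f) x * g x‖ₑ ∂(lebesgueOn a b) ≤ E.assocNorm g :=
      le_iSup_of_le _ (le_iSup_of_le (hf.1.const_smul _) (le_iSup_of_le hle le_rfl))
    have h2 : ∀ x, ‖((E.fnorm f).toReal⁻¹ • f) x * g x‖ₑ = (E.fnorm f)⁻¹ * ‖f x * g x‖ₑ := by
      intro x
      rw [Pi.smul_apply, smul_eq_mul, mul_assoc, enorm_mul, Real.enorm_of_nonneg (by positivity),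
        ENNReal.ofReal_inv_of_pos hpos, ENNReal.ofReal_toReal hfin]
    simp only [h2] at h1
    rw [lintegral_const_mul' _ _ (ENNReal.inv_ne_top.2 h0)] at h1
    rwa [mul_comm, ← div_eq_mul_inv, ENNReal.div_le_iff h0 hfin, mul_comm] at h1

theorem integrable_mul (hf : E.lat.Mem f) (hg : E.assocLat.Mem g) :
    Integrable (fun x => f x * g x) (lebesgueOn a b) :=
  ⟨hf.1.mul hg.1, (lintegral_mul_le hf g).trans_lt (ENNReal.mul_lt_top hf.2 hg.2)⟩

theorem integral_abs_mul_le (hf : E.lat.Mem f) (hg : E.assocLat.Mem g) :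
    ∫ x, |f x * g x| ∂(lebesgueOn a b) ≤ E.lat.nrm f * E.assocLat.nrm g := by
  have h1 : ∫ x, |f x * g x| ∂(lebesgueOn a b)
      = (∫⁻ x, ‖f x * g x‖ₑ ∂(lebesgueOn a b)).toReal :=
    integral_norm_eq_lintegral_enorm (hf.1.mul hg.1)
  rw [h1, LatticeNorm.nrm, LatticeNorm.nrm, ← ENNReal.toReal_mul]
  exact ENNReal.toReal_mono (ENNReal.mul_lt_top hf.2 hg.2).ne (lintegral_mul_le hf g)

theorem memAssoc_iff : E.MemAssoc g ↔ E.assocLat.Mem g :=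
  ⟨fun h => ⟨h.1, E.assocNorm_lt_top h⟩, fun h => ⟨h.1, fun _ hf => integrable_mul hf h⟩⟩

/-- The associate norm is nearly attained by a nonnegative function with prescribed support. -/
theorem exists_nearly_norming (hg : E.assocLat.Mem g) {J : Set ℝ} (hJ : MeasurableSet J) :
    ∃ f : ℝ → ℝ, E.lat.Mem f ∧ E.lat.nrm f ≤ 1 ∧ (∀ x, 0 ≤ f x) ∧ (∀ x, x ∉ J → f x = 0) ∧
      E.assocLat.nrm (J.indicator g) / 2 ≤ ∫ x, f x * |g x| ∂(lebesgueOn a b) := by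
  have hgJ := hg.indicator hJ
  rcases (E.assocLat.nrm_nonneg (J.indicator g)).eq_or_lt with h0 | h0
  · refine ⟨fun _ => 0, LatticeNorm.mem_const 0, ?_, fun _ => le_rfl, fun _ _ => rfl, ?_⟩
    · rw [LatticeNorm.nrm_zero]
      exact zero_le_one
    · simp [← h0]
  · have h1 : ENNReal.ofReal (E.assocLat.nrm (J.indicator g) / 2) < E.assocNorm (J.indicator g) := by
      have h2 : E.assocNorm (J.indicator g) = ENNReal.ofReal (E.assocLat.nrm (J.indicator g)) :=
        (ENNReal.ofReal_toReal hgJ.2.ne).symm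
      rw [h2, ENNReal.ofReal_lt_ofReal_iff h0]
      linarith
    rw [assocNorm] at h1
    simp only [lt_iSup_iff] at h1
    obtain ⟨f, hf, hf1, hfg⟩ := h1
    have hfm : E.lat.Mem f := ⟨hf, hf1.trans_lt ENNReal.one_lt_top⟩
    refine ⟨J.indicator fun x => |f x|, hfm.abs.indicator hJ, ?_, ?_, fun x hx => ?_, ?_⟩
    · refine (hfm.abs.nrm_indicator_le hJ).trans ?_
      rw [hfm.nrm_abs]
      exact ENNReal.toReal_le_of_le_ofReal zero_le_one (by rw [ENNReal.ofReal_one]; exact hf1)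
    · exact indicator_nonneg fun x _ => abs_nonneg _
    · exact indicator_of_notMem hx _
    · have h3 : ∀ x, J.indicator (fun x => |f x|) x * |g x| = ‖f x * J.indicator g x‖ := by
        intro x
        by_cases hx : x ∈ J <;> simp [hx]
      simp only [h3]
      refine le_of_le_of_eq ?_ (integral_norm_eq_lintegral_enorm (hf.mul hgJ.1)).symm
      refine (ENNReal.ofReal_le_iff_le_toReal ?_).1 hfg.le
      exact ((lintegral_mul_le hfm _).trans_lt (ENNReal.mul_lt_top hfm.2 hgJ.2)).ne

end BanachFunctionSpace

/-! ### Divisions of the interval -/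

/-- `t 0 ≤ t 1 ≤ … ≤ t N` divides `[a, b]` into `N` intervals; `t` is constant from `N` on. -/
structure IsDivision (a b : ℝ) (t : ℕ → ℝ) (N : ℕ) : Prop where
  mono : Monotone t
  zero : t 0 = a
  eq_of_ge : ∀ i, N ≤ i → t i = b

namespace IsDivision

variable {a b : ℝ} {t : ℕ → ℝ} {N : ℕ}

theorem left_le (h : IsDivision a b t N) (i : ℕ) : a ≤ t i := h.zero ▸ h.mono (Nat.zero_le i)

theorem le_right (h : IsDivision a b t N) (i : ℕ) : t i ≤ b :=
  (h.mono (le_max_left i N)).trans_eq (h.eq_of_ge _ (le_max_right i N))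

theorem cell_subset (h : IsDivision a b t N) (i : ℕ) : Ioo (t i) (t (i + 1)) ⊆ Ioo a b :=
  Ioo_subset_Ioo (h.left_le i) (h.le_right (i + 1))

theorem cell_disjoint (h : IsDivision a b t N) {i j : ℕ} (hij : i ≠ j) :
    Disjoint (Ioo (t i) (t (i + 1))) (Ioo (t j) (t (j + 1))) :=
  h.mono.pairwise_disjoint_on_Ioo_succ hij

theorem cell_eq_empty (h : IsDivision a b t N) {i : ℕ} (hi : N ≤ i) :
    Ioo (t i) (t (i + 1)) = ∅ := by
  rw [h.eq_of_ge i hi, h.eq_of_ge (i + 1) (hi.trans i.le_succ), Ioo_self]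

theorem exists_mem_cell (h : IsDivision a b t N) {x : ℝ} (hx : x ∈ Ioo a b)
    (hxt : x ∉ range t) : ∃ i < N, x ∈ Ioo (t i) (t (i + 1)) := by
  classical
  have hex : ∃ k, x < t k := ⟨N, by rw [h.eq_of_ge N le_rfl]; exact hx.2⟩
  have h0 : Nat.find hex ≠ 0 := by
    intro h0
    have := Nat.find_spec hex
    rw [h0, h.zero] at this
    exact absurd hx.1 this.not_gt
  obtain ⟨i, hi⟩ := Nat.exists_eq_succ_of_ne_zero h0
  refine ⟨i, ?_, lt_of_le_of_ne ?_ ?_, ?_⟩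
  · have : Nat.find hex ≤ N := Nat.find_min' hex (by rw [h.eq_of_ge N le_rfl]; exact hx.2)
    omega
  · exact not_lt.1 (Nat.find_min hex (by omega))
  · exact fun hti => hxt ⟨i, hti⟩
  · have := Nat.find_spec hex
    rwa [hi] at this

theorem isIntervalPartition (h : IsDivision a b t N) :
    BanachFunctionSpace.IsIntervalPartition a b fun i => Ioo (t i) (t (i + 1)) := by
  refine ⟨fun i => ⟨ordConnected_Ioo, h.cell_subset i⟩, fun i j hij => h.cell_disjoint hij, ?_⟩
  refine measure_mono_null ?_ ((countable_range t).measure_zero volume)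
  rintro x ⟨hx, hxU⟩
  by_contra hxt
  obtain ⟨i, -, hi⟩ := h.exists_mem_cell hx hxt
  exact hxU (mem_iUnion.2 ⟨i, hi⟩)

end IsDivision

/-! ### Localisation on cells and its dual form -/

namespace BanachFunctionSpace

variable {a b : ℝ} (E : BanachFunctionSpace a b) {f g u v w : ℝ → ℝ}

/-- Cellwise domination of norms implies domination of norms, up to the factor `D`. -/
def CellwiseBound (D : ℝ) : Prop :=
  ∀ (t : ℕ → ℝ) (N : ℕ), IsDivision a b t N → ∀ f g : ℝ → ℝ, E.lat.Mem f → E.lat.Mem g →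
    ∀ c : ℝ, 0 ≤ c → (∀ i < N, E.lat.nrm ((Ioo (t i) (t (i + 1))).indicator g) ≤
      c * E.lat.nrm ((Ioo (t i) (t (i + 1))).indicator f)) → E.lat.nrm g ≤ D * c * E.lat.nrm f

variable {E}

theorem partitionAverage_eq_sum {t : ℕ → ℝ} {N : ℕ} (h : IsDivision a b t N) (f : ℝ → ℝ) :
    E.partitionAverage (fun i => Ioo (t i) (t (i + 1))) f = ∑ i ∈ Finset.range N,
      (Ioo (t i) (t (i + 1))).indicator fun _ =>
        E.lat.nrm ((Ioo (t i) (t (i + 1))).indicator f) /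
          E.lat.nrm ((Ioo (t i) (t (i + 1))).indicator fun _ => 1) := by
  ext x
  rw [Finset.sum_apply, partitionAverage, tsum_eq_sum (s := Finset.range N)]
  · simp only [ENNReal.toReal_div]
    rfl
  · intro i hi
    rw [h.cell_eq_empty (by simpa using hi), indicator_empty]

/-- The cellwise hypothesis gives a pointwise inequality between the two partition averages. Passing
from `g` to its average and from the average of `f` back to `f` costs a factor `C` each, hence `D =
C * C`. -/
theorem PartitionEstimate.exists_cellwiseBound (h : E.PartitionEstimate) :
    ∃ D, 0 < D ∧ E.CellwiseBound D := by
  obtain ⟨C, hC, H⟩ := h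
  have hC' : (0 : ℝ) < C := hC
  refine ⟨C * C, by positivity, fun t N ht f g hf hg c hc hcell => ?_⟩
  set Q : ℕ → Set ℝ := fun i => Ioo (t i) (t (i + 1)) with hQ
  have hmem : ∀ k : ℝ → ℝ, E.lat.Mem (E.partitionAverage Q k) := fun k => by
    rw [hQ, partitionAverage_eq_sum ht]
    exact LatticeNorm.Mem.sum fun i _ => (LatticeNorm.mem_const _).indicator measurableSet_Ioo
  have h1 : E.lat.nrm g ≤ C * E.lat.nrm (E.partitionAverage Q g) := by
    have := ENNReal.toReal_mono (hmem g).2.ne (H g hg Q ht.isIntervalPartition).1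
    rw [ENNReal.toReal_mul, ENNReal.toReal_inv, ENNReal.coe_toReal] at this
    rwa [inv_mul_le_iff₀ hC'] at this
  have h2 : E.lat.nrm (E.partitionAverage Q f) ≤ C * E.lat.nrm f := by
    have := ENNReal.toReal_mono (ENNReal.mul_lt_top ENNReal.coe_lt_top hf.2).ne
      (H f hf Q ht.isIntervalPartition).2
    rwa [ENNReal.toReal_mul, ENNReal.coe_toReal] at this
  have h3 : E.lat.nrm (E.partitionAverage Q g) ≤ c * E.lat.nrm (E.partitionAverage Q f) := by
    rw [← abs_of_nonneg hc, ← LatticeNorm.nrm_smul c (hmem f).1]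
    refine ((hmem f).smul c).nrm_le (hmem g).1 (.of_forall fun x => ?_)
    rw [Pi.smul_apply, smul_eq_mul, hQ, partitionAverage_eq_sum ht, partitionAverage_eq_sum ht,
      Finset.sum_apply, Finset.sum_apply, Finset.mul_sum]
    have hnn : ∀ k : ℝ → ℝ, ∀ i, 0 ≤ (Q i).indicator (fun _ =>
        E.lat.nrm ((Q i).indicator k) / E.lat.nrm ((Q i).indicator fun _ => 1)) x := fun k i =>
      indicator_nonneg (fun _ _ => div_nonneg (E.lat.nrm_nonneg _) (E.lat.nrm_nonneg _)) x
    rw [abs_of_nonneg (Finset.sum_nonneg fun i _ => hnn g i)]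
    refine le_trans (Finset.sum_le_sum fun i hi => ?_) (le_abs_self _)
    by_cases hx : x ∈ Ioo (t i) (t (i + 1))
    · rw [indicator_of_mem hx, indicator_of_mem hx, ← mul_div_assoc]
      exact div_le_div_of_nonneg_right (hcell i (by simpa using hi)) (E.lat.nrm_nonneg _)
    · rw [indicator_of_notMem hx, indicator_of_notMem hx, mul_zero]
  calc E.lat.nrm g ≤ C * (c * (C * E.lat.nrm f)) := by
        refine h1.trans ?_
        gcongr
        exact h3.trans (by gcongr)
    _ = _ := by ring

/-- Let `k i` nearly norm `g` on the `i`th cell and `F = ∑ ‖f χᵢ‖ k i`. Cellwise `F` is dominated by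
`f`, so `‖F‖ ≤ D ‖f‖`, while `∫ F |g|` is at least half of the sum on the left. This controls the
total error of replacing the weights, independently of the number of cells. -/
theorem CellwiseBound.sum_le {D : ℝ} (hD : E.CellwiseBound D) {t : ℕ → ℝ} {N : ℕ}
    (ht : IsDivision a b t N) (hf : E.lat.Mem f) (hg : E.assocLat.Mem g) :
    ∑ i ∈ Finset.range N, E.lat.nrm ((Ioo (t i) (t (i + 1))).indicator f) *
      E.assocLat.nrm ((Ioo (t i) (t (i + 1))).indicator g) ≤
      2 * D * (E.lat.nrm f * E.assocLat.nrm g) := by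
  choose k hk hk1 hk0 hksupp hkg using fun i : ℕ =>
    exists_nearly_norming hg (measurableSet_Ioo (a := t i) (b := t (i + 1)))
  let c : ℕ → ℝ := fun i => E.lat.nrm ((Ioo (t i) (t (i + 1))).indicator f)
  have hc : ∀ i, 0 ≤ c i := fun i => E.lat.nrm_nonneg _
  let F : ℝ → ℝ := ∑ i ∈ Finset.range N, c i • k i
  have hF : E.lat.Mem F := LatticeNorm.Mem.sum fun i _ => (hk i).smul _
  have hcell : ∀ i < N, (Ioo (t i) (t (i + 1))).indicator F =
      (Ioo (t i) (t (i + 1))).indicator (c i • k i) := by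
    intro i hi
    ext x
    by_cases hx : x ∈ Ioo (t i) (t (i + 1))
    · rw [indicator_of_mem hx, indicator_of_mem hx]
      refine (Finset.sum_apply x _ _).trans ?_
      refine Finset.sum_eq_single i (fun j _ hji => ?_) (fun h => absurd (by simpa using hi) h)
      rw [Pi.smul_apply, hksupp j x (disjoint_left.1 (ht.cell_disjoint hji.symm) hx), smul_zero]
    · rw [indicator_of_notMem hx, indicator_of_notMem hx]
  have hFf : E.lat.nrm F ≤ D * 1 * E.lat.nrm f := by
    refine hD t N ht f F hf hF 1 zero_le_one fun i hi => ?_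
    rw [hcell i hi, one_mul]
    refine (((hk i).smul _).nrm_indicator_le measurableSet_Ioo).trans ?_
    rw [LatticeNorm.nrm_smul _ (hk i).1, abs_of_nonneg (hc i)]
    exact mul_le_of_le_one_right (hc i) (hk1 i)
  have hint : ∀ i, Integrable (fun x => k i x * |g x|) (lebesgueOn a b) := fun i =>
    integrable_mul (hk i) hg.abs
  have h1 : ∑ i ∈ Finset.range N, c i * ∫ x, k i x * |g x| ∂lebesgueOn a b
      ≤ E.lat.nrm F * E.assocLat.nrm g := by
    refine le_trans (le_of_eq ?_) (integral_abs_mul_le hF hg)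
    have h2 : ∀ x, |F x * g x| = ∑ i ∈ Finset.range N, c i * (k i x * |g x|) := by
      intro x
      have hF0 : F x = ∑ i ∈ Finset.range N, c i * k i x := by simp [F]
      rw [abs_mul, hF0, abs_of_nonneg (Finset.sum_nonneg fun i _ => mul_nonneg (hc i) (hk0 i x)),
        Finset.sum_mul]
      exact Finset.sum_congr rfl fun i _ => by ring
    simp only [h2]
    rw [integral_finsetSum _ fun i _ => (hint i).const_mul _]
    exact Finset.sum_congr rfl fun i _ => (integral_const_mul _ _).symm
  have h3 : ∑ i ∈ Finset.range N, c i * (E.assocLat.nrm ((Ioo (t i) (t (i + 1))).indicator g) / 2)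
      ≤ ∑ i ∈ Finset.range N, c i * ∫ x, k i x * |g x| ∂lebesgueOn a b :=
    Finset.sum_le_sum fun i _ => mul_le_mul_of_nonneg_left (hkg i) (hc i)
  have h4 := mul_le_mul_of_nonneg_right hFf (E.assocLat.nrm_nonneg g)
  have h5 : ∑ i ∈ Finset.range N, c i * (E.assocLat.nrm ((Ioo (t i) (t (i + 1))).indicator g) / 2)
      = (∑ i ∈ Finset.range N, c i * E.assocLat.nrm ((Ioo (t i) (t (i + 1))).indicator g)) / 2 := by
    rw [Finset.sum_div]
    exact Finset.sum_congr rfl fun i _ => by ring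
  rw [h5] at h3
  linarith

/-! ### Primitives, elements of the Banach space and the Hardy operator -/

theorem intervalIntegrable_of_mem {c d : ℝ} (hw : Integrable w (lebesgueOn a b))
    (hc : c ∈ Icc a b) (hd : d ∈ Icc a b) : IntervalIntegrable w volume c d := by
  have h1 : IntegrableOn w (Icc a b) := by
    rw [integrableOn_Icc_iff_integrableOn_Ioo]
    exact hw
  exact (h1.mono_set (uIcc_subset_Icc hc hd)).intervalIntegrable

theorem integral_Ioo_lebesgueOn {c d : ℝ} (hac : a ≤ c) (hcd : c ≤ d) (hdb : d ≤ b) :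
    ∫ x in c..d, w x = ∫ x, (Ioo c d).indicator w x ∂lebesgueOn a b := by
  rw [intervalIntegral.integral_of_le hcd, integral_indicator measurableSet_Ioo,
    Measure.restrict_restrict measurableSet_Ioo, inter_eq_left.2 (Ioo_subset_Ioo hac hdb),
    integral_Ioc_eq_integral_Ioo]

theorem integral_abs_mul_interval_le (hf : E.lat.Mem f) (hu : E.assocLat.Mem u) {c d : ℝ}
    (hac : a ≤ c) (hcd : c ≤ d) (hdb : d ≤ b) :
    ∫ x in c..d, |f x * u x| ≤
      E.lat.nrm ((Ioo c d).indicator f) * E.assocLat.nrm ((Ioo c d).indicator u) := by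
  rw [integral_Ioo_lebesgueOn hac hcd hdb]
  refine le_trans (le_of_eq (integral_congr_ae (.of_forall fun x => ?_)))
    (integral_abs_mul_le (hf.indicator measurableSet_Ioo) (hu.indicator measurableSet_Ioo))
  by_cases hx : x ∈ Ioo c d <;> simp [hx]

theorem aestronglyMeasurable_primitive (hw : Integrable w (lebesgueOn a b)) :
    AEStronglyMeasurable (fun x => ∫ t in a..x, w t) (lebesgueOn a b) := by
  -- Integrability of `w` is known on `(a, b)` only; the extension by zero has a primitive that is
  -- continuous on the whole line.
  have h1 : Integrable ((Ioo a b).indicator w) volume :=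
    (integrable_indicator_iff measurableSet_Ioo).2 hw
  have h2 := (intervalIntegral.continuous_primitive (fun c d => h1.intervalIntegrable (a := c)
    (b := d)) a).aestronglyMeasurable (μ := lebesgueOn a b)
  refine h2.congr ?_
  filter_upwards [ae_restrict_mem measurableSet_Ioo] with x hx
  rw [intervalIntegral.integral_of_le hx.1.le, intervalIntegral.integral_of_le hx.1.le]
  exact setIntegral_congr_fun measurableSet_Ioc fun y hy =>
    indicator_of_mem (show y ∈ Ioo a b from ⟨hy.1, hy.2.trans_lt hx.2⟩) _

theorem mem_coe (f : E.Space) : E.lat.Mem f :=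
  ⟨(E.toFun f).aestronglyMeasurable, E.fnorm_coe_lt_top f⟩

theorem norm_eq_nrm (f : E.Space) : ‖f‖ = E.lat.nrm f := rfl

theorem coe_add (f g : E.Space) : (f + g : E.Space) =ᵐ[lebesgueOn a b] fun x => f x + g x :=
  AEEqFun.coeFn_add (E.toFun f) (E.toFun g)

theorem coe_smul (c : ℝ) (f : E.Space) : (c • f : E.Space) =ᵐ[lebesgueOn a b] fun x => c * f x :=
  AEEqFun.coeFn_smul c (E.toFun f)

theorem coe_sub (f g : E.Space) : (f - g : E.Space) =ᵐ[lebesgueOn a b] fun x => f x - g x :=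
  AEEqFun.coeFn_sub (E.toFun f) (E.toFun g)

theorem coe_zero : ((0 : E.Space) : ℝ → ℝ) =ᵐ[lebesgueOn a b] fun _ => 0 :=
  AEEqFun.coeFn_zero

theorem coe_sum {ι : Type*} (s : Finset ι) (F : ι → E.Space) :
    (∑ i ∈ s, F i : E.Space) =ᵐ[lebesgueOn a b] fun x => ∑ i ∈ s, F i x := by
  classical
  induction s using Finset.induction_on with
  | empty => simpa using coe_zero
  | insert i s hi ih =>
    rw [Finset.sum_insert hi]
    filter_upwards [coe_add (F i) (∑ i ∈ s, F i), ih] with x hx hx'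
    rw [hx, hx', Finset.sum_insert hi]

theorem space_ext {f g : E.Space} (h : f =ᵐ[lebesgueOn a b] g) : f = g :=
  Subtype.ext (AEEqFun.ext h)

/-- The element of the Banach space given by a function of finite norm. -/
noncomputable def toSpace (f : ℝ → ℝ) (hf : E.lat.Mem f) : E.Space :=
  (⟨AEEqFun.mk f hf.1, (E.fnorm_congr _ _ (AEEqFun.aestronglyMeasurable _) hf.1
    (AEEqFun.coeFn_mk f hf.1)).trans_lt hf.2⟩ : E.toSubmodule)

theorem coe_toSpace (hf : E.lat.Mem f) : (E.toSpace f hf : ℝ → ℝ) =ᵐ[lebesgueOn a b] f :=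
  AEEqFun.coeFn_mk f hf.1

theorem norm_toSpace (hf : E.lat.Mem f) : ‖E.toSpace f hf‖ = E.lat.nrm f :=
  LatticeNorm.nrm_congr (L := E.lat) hf.1 (coe_toSpace hf)

/-- The restriction of the elements of the Banach space to a measurable set. -/
noncomputable def restrictL (E : BanachFunctionSpace a b) (S : Set ℝ) (hS : MeasurableSet S) :
    E.Space →L[ℝ] E.Space :=
  LinearMap.mkContinuous
    { toFun := fun f => toSpace (S.indicator f) ((mem_coe f).indicator hS)
      map_add' := fun f g => space_ext <| by
        filter_upwards [coe_toSpace ((mem_coe (f + g)).indicator hS),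
          coe_toSpace ((mem_coe f).indicator hS), coe_toSpace ((mem_coe g).indicator hS),
          coe_add f g, coe_add (toSpace (S.indicator f) ((mem_coe f).indicator hS))
            (toSpace (S.indicator g) ((mem_coe g).indicator hS))] with x h1 h2 h3 h4 h5
        rw [h1, h5, h2, h3]
        by_cases hx : x ∈ S <;> simp [hx, h4]
      map_smul' := fun c f => space_ext <| by
        filter_upwards [coe_toSpace ((mem_coe (c • f)).indicator hS),
          coe_toSpace ((mem_coe f).indicator hS), coe_smul c f,
          coe_smul c (toSpace (S.indicator f) ((mem_coe f).indicator hS))] with x h1 h2 h3 h4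
        rw [RingHom.id_apply, h1, h4, h2]
        by_cases hx : x ∈ S <;> simp [hx, h3] }
    1 (fun f => by
      rw [one_mul]
      exact (norm_toSpace ((mem_coe f).indicator hS)).trans_le ((mem_coe f).nrm_indicator_le hS))

theorem coe_restrictL {S : Set ℝ} (hS : MeasurableSet S) (f : E.Space) :
    (E.restrictL S hS f : ℝ → ℝ) =ᵐ[lebesgueOn a b] S.indicator f :=
  coe_toSpace ((mem_coe f).indicator hS)

theorem norm_restrictL {S : Set ℝ} (hS : MeasurableSet S) (f : E.Space) :
    ‖E.restrictL S hS f‖ = E.lat.nrm (S.indicator f) :=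
  norm_toSpace ((mem_coe f).indicator hS)

theorem integral_congr_lebesgueOn {k : ℝ → ℝ} {c d : ℝ} (hac : a ≤ c) (hcd : c ≤ d)
    (hdb : d ≤ b) (h : w =ᵐ[lebesgueOn a b] k) : ∫ x in c..d, w x = ∫ x in c..d, k x := by
  rw [integral_Ioo_lebesgueOn hac hcd hdb, integral_Ioo_lebesgueOn hac hcd hdb]
  refine integral_congr_ae (h.mono fun x hx => ?_)
  by_cases hx' : x ∈ Ioo c d <;> simp [hx', hx]

/-- Integration against `u` over `(a, d)`. -/
noncomputable def integralL (hu : E.assocLat.Mem u) {d : ℝ} (had : a ≤ d) (hdb : d ≤ b) :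
    StrongDual ℝ E.Space :=
  LinearMap.mkContinuous
    { toFun := fun f => ∫ x in a..d, f x * u x
      map_add' := fun f g => by
        have hi : ∀ k : E.Space, IntervalIntegrable (fun x => k x * u x) volume a d := fun k =>
          intervalIntegrable_of_mem (integrable_mul (mem_coe k) hu) ⟨le_rfl, had.trans hdb⟩
            ⟨had, hdb⟩
        rw [← intervalIntegral.integral_add (hi f) (hi g)]
        refine integral_congr_lebesgueOn le_rfl had hdb ((coe_add f g).mono fun x hx => ?_)
        change _ * _ = _
        rw [hx]
        ring
      map_smul' := fun c f => by
        rw [RingHom.id_apply, smul_eq_mul, ← intervalIntegral.integral_const_mul]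
        refine integral_congr_lebesgueOn le_rfl had hdb ((coe_smul c f).mono fun x hx => ?_)
        change _ * _ = _
        rw [hx]
        ring }
    (E.assocLat.nrm u) (fun f => by
      change ‖∫ x in a..d, f x * u x‖ ≤ _
      refine (intervalIntegral.norm_integral_le_integral_norm had).trans ?_
      refine (integral_abs_mul_interval_le (mem_coe f) hu le_rfl had hdb).trans ?_
      rw [mul_comm, norm_eq_nrm]
      gcongr
      · exact E.lat.nrm_nonneg _
      · exact E.assocLat.nrm_nonneg _
      · exact hu.nrm_indicator_le measurableSet_Ioo
      · exact (mem_coe f).nrm_indicator_le measurableSet_Ioo)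

theorem abs_primitive_le (hf : E.lat.Mem f) (hu : E.assocLat.Mem u) {x : ℝ} (hx : x ∈ Ioo a b) :
    |∫ t in a..x, f t * u t| ≤ E.lat.nrm f * E.assocLat.nrm u := by
  refine (intervalIntegral.abs_integral_le_integral_abs hx.1.le).trans ?_
  refine (integral_abs_mul_interval_le hf hu le_rfl hx.1.le hx.2.le).trans ?_
  gcongr
  · exact E.assocLat.nrm_nonneg _
  · exact E.lat.nrm_nonneg _
  · exact hf.nrm_indicator_le measurableSet_Ioo
  · exact hu.nrm_indicator_le measurableSet_Ioo

theorem hardy_mem_and_nrm_le (hu : E.assocLat.Mem u) (hv : E.lat.Mem v) (hf : E.lat.Mem f) :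
    E.lat.Mem (fun x => v x * ∫ t in a..x, f t * u t) ∧
      E.lat.nrm (fun x => v x * ∫ t in a..x, f t * u t) ≤
        E.lat.nrm v * E.assocLat.nrm u * E.lat.nrm f := by
  have hm : AEStronglyMeasurable (fun x => v x * ∫ t in a..x, f t * u t) (lebesgueOn a b) :=
    hv.1.mul (aestronglyMeasurable_primitive (integrable_mul hf hu))
  have h0 : 0 ≤ E.lat.nrm f * E.assocLat.nrm u :=
    mul_nonneg (E.lat.nrm_nonneg _) (E.assocLat.nrm_nonneg _)
  have hle : ∀ᵐ x ∂lebesgueOn a b, |v x * ∫ t in a..x, f t * u t| ≤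
      |((E.lat.nrm f * E.assocLat.nrm u) • v) x| := by
    filter_upwards [ae_restrict_mem measurableSet_Ioo] with x hx
    rw [abs_mul, Pi.smul_apply, smul_eq_mul, abs_mul, abs_of_nonneg h0, mul_comm]
    exact mul_le_mul_of_nonneg_right (abs_primitive_le hf hu hx) (abs_nonneg _)
  refine ⟨(hv.smul _).of_abs_le hm hle, ((hv.smul _).nrm_le hm hle).trans (le_of_eq ?_)⟩
  rw [LatticeNorm.nrm_smul _ hv.1, abs_of_nonneg h0]
  ring

/-- The Hardy operator `f ↦ v ∫ₐ u f`. -/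
noncomputable def hardy (hu : E.assocLat.Mem u) (hv : E.lat.Mem v) : E.Space →L[ℝ] E.Space :=
  LinearMap.mkContinuous
    { toFun := fun f => toSpace _ (hardy_mem_and_nrm_le hu hv (mem_coe f)).1
      map_add' := fun f g => space_ext <| by
        filter_upwards [coe_toSpace (hardy_mem_and_nrm_le hu hv (mem_coe (f + g))).1,
          coe_toSpace (hardy_mem_and_nrm_le hu hv (mem_coe f)).1,
          coe_toSpace (hardy_mem_and_nrm_le hu hv (mem_coe g)).1,
          coe_add (toSpace _ (hardy_mem_and_nrm_le hu hv (mem_coe f)).1)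
            (toSpace _ (hardy_mem_and_nrm_le hu hv (mem_coe g)).1),
          ae_restrict_mem measurableSet_Ioo] with x h1 h2 h3 h4 hx
        rw [h1, h4, h2, h3, ← mul_add]
        congr 1
        -- At a fixed `x` the primitive is the linear functional `integralL` with endpoint `x`.
        exact map_add (integralL hu hx.1.le hx.2.le) f g
      map_smul' := fun c f => space_ext <| by
        filter_upwards [coe_toSpace (hardy_mem_and_nrm_le hu hv (mem_coe (c • f))).1,
          coe_toSpace (hardy_mem_and_nrm_le hu hv (mem_coe f)).1,
          coe_smul c (toSpace _ (hardy_mem_and_nrm_le hu hv (mem_coe f)).1),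
          ae_restrict_mem measurableSet_Ioo] with x h1 h2 h3 hx
        rw [RingHom.id_apply, h1, h3, h2, mul_left_comm]
        congr 1
        exact map_smul (integralL hu hx.1.le hx.2.le) c f }
    (E.lat.nrm v * E.assocLat.nrm u) (fun f => by
      exact (norm_toSpace (hardy_mem_and_nrm_le hu hv (mem_coe f)).1).trans_le
        (hardy_mem_and_nrm_le hu hv (mem_coe f)).2)

theorem coe_hardy (hu : E.assocLat.Mem u) (hv : E.lat.Mem v) (f : E.Space) :
    (hardy hu hv f : ℝ → ℝ) =ᵐ[lebesgueOn a b] fun x => v x * ∫ t in a..x, f t * u t :=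
  coe_toSpace (hardy_mem_and_nrm_le hu hv (mem_coe f)).1

end BanachFunctionSpace

/-! ### Minimal divisions and counting of cells -/

namespace IsDivision

variable {a b : ℝ} {t : ℕ → ℝ} {N : ℕ}

/-- The node `t (i + 1)` is removed; `i < N` ensures that it is not the last one. -/
theorem merge (h : IsDivision a b t (N + 1)) {i : ℕ} (hi : i < N) :
    IsDivision a b (fun j => if j ≤ i then t j else t (j + 1)) N where
  mono := by
    intro j k hjk
    dsimp only
    split_ifs with h1 h2
    · exact h.mono hjk
    · exact h.mono (by omega)
    · omega
    · exact h.mono (by omega)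
  zero := by simp [h.zero]
  eq_of_ge j hj := by
    rw [if_neg (by omega)]
    exact h.eq_of_ge _ (by omega)

/-- Cells are joined in pairs. The extra cell in `N / 2 + 1` takes up a possible unpaired last cell;
for even `N` it is empty. -/
theorem double (h : IsDivision a b t N) : IsDivision a b (fun j => t (2 * j)) (N / 2 + 1) where
  mono := fun j k hjk => h.mono (by omega)
  zero := h.zero
  eq_of_ge j hj := h.eq_of_ge _ (by omega)

theorem exists_mesh_le (hab : a < b) {η : ℝ} (hη : 0 < η) :
    ∃ N t, IsDivision a b t N ∧ ∀ i, t (i + 1) - t i ≤ η := by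
  refine ⟨⌈(b - a) / η⌉₊, fun i => min b (a + i * η), ⟨?_, ?_, ?_⟩, fun i => ?_⟩
  · intro i j hij
    dsimp only
    gcongr
  · simp [hab.le]
  · intro i hi
    refine min_eq_left ?_
    have : (b - a) / η ≤ i := (Nat.le_ceil _).trans (by exact_mod_cast hi)
    rw [div_le_iff₀ hη] at this
    linarith
  · push_cast
    rcases le_total b (a + i * η) with h | h
    · rw [min_eq_left h, min_eq_left (by nlinarith)]
      linarith
    · rw [min_eq_right h]
      linarith [min_le_right b (a + (i + 1) * η)]

/-- For the least possible `N`, two adjacent cells with small union could be merged into one, which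
contradicts minimality. -/
theorem exists_minimal (φ : ℝ → ℝ → ℝ) (ε : ℝ)
    (h : ∃ N t, IsDivision a b t N ∧ ∀ i < N, φ (t i) (t (i + 1)) ≤ ε) :
    ∃ N t, IsDivision a b t N ∧ (∀ i < N, φ (t i) (t (i + 1)) ≤ ε) ∧
      ∀ i, i + 2 ≤ N → ε < φ (t i) (t (i + 2)) := by
  classical
  obtain ⟨t, ht, hε⟩ := Nat.find_spec h
  refine ⟨Nat.find h, t, ht, hε, fun i hi => ?_⟩
  by_contra! hle
  obtain ⟨m, hm⟩ : ∃ m, Nat.find h = m + 1 := ⟨Nat.find h - 1, by omega⟩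
  rw [hm] at ht hi hε
  refine Nat.find_min h (m := m) (by omega) ⟨_, ht.merge (i := i) (by omega), fun j hj => ?_⟩
  rcases lt_trichotomy j i with h1 | h1 | h1
  · rw [if_pos h1.le, if_pos (by omega)]
    exact hε j (by omega)
  · subst h1
    rw [if_pos le_rfl, if_neg (by omega)]
    exact hle
  · rw [if_neg (by omega), if_neg (by omega)]
    exact hε (j + 1) (by omega)

theorem card_long_mul_le (h : IsDivision a b t N) {S : Finset ℕ} (hS : S ⊆ Finset.range N) {η : ℝ}
    (hlong : ∀ i ∈ S, η ≤ t (i + 1) - t i) : S.card * η ≤ b - a := by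
  calc S.card * η = ∑ i ∈ S, η := by simp
    _ ≤ ∑ i ∈ S, (t (i + 1) - t i) := Finset.sum_le_sum hlong
    _ ≤ ∑ i ∈ Finset.range N, (t (i + 1) - t i) :=
        Finset.sum_le_sum_of_subset_of_nonneg hS fun i _ _ => sub_nonneg.2 (h.mono i.le_succ)
    _ = b - a := by rw [Finset.sum_range_sub, h.zero, h.eq_of_ge N le_rfl]

theorem sum_integral (h : IsDivision a b t N) {w : ℝ → ℝ} (hw : Continuous w) :
    ∑ i ∈ Finset.range N, ∫ x in t i..t (i + 1), w x = ∫ x in a..b, w x := by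
  rw [intervalIntegral.sum_integral_adjacent_intervals fun i _ => hw.intervalIntegrable _ _,
    h.zero, h.eq_of_ge N le_rfl]

end IsDivision

/-! ### Norm comparisons on a subset -/

namespace LatticeNorm

variable {μ : Measure ℝ} {L : LatticeNorm μ} {k : ℝ → ℝ}

theorem nrm_indicator_le_of_abs_le (hk : AEStronglyMeasurable k μ) {S : Set ℝ}
    (hS : MeasurableSet S) {m : ℝ} (hm : 0 ≤ m) (h : ∀ x ∈ S, |k x| ≤ m) :
    L.nrm (S.indicator k) ≤ m * L.nrm (S.indicator fun _ => 1) := by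
  have h1 : L.Mem (S.indicator fun _ => (1 : ℝ)) := mem_one.indicator hS
  rw [← abs_of_nonneg hm, ← nrm_smul m h1.1]
  refine (h1.smul m).nrm_le (hk.indicator hS) (.of_forall fun x => ?_)
  by_cases hx : x ∈ S
  · simpa [hx] using (h x hx).trans (le_abs_self m)
  · simp [hx]

theorem Mem.le_nrm_indicator (hk : L.Mem k) {S : Set ℝ}
    (hS : MeasurableSet S) {m : ℝ} (hm : 0 ≤ m) (h : ∀ x ∈ S, m ≤ |k x|) :
    m * L.nrm (S.indicator fun _ => 1) ≤ L.nrm (S.indicator k) := by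
  have h1 : L.Mem (S.indicator fun _ => (1 : ℝ)) := mem_one.indicator hS
  rw [← abs_of_nonneg hm, ← nrm_smul m h1.1]
  refine (hk.indicator hS).nrm_le (h1.smul m).1 (.of_forall fun x => ?_)
  by_cases hx : x ∈ S
  · simpa [hx, abs_of_nonneg hm] using h x hx
  · simp [hx]

theorem Mem.nrm_indicator_le_add {f g : ℝ → ℝ} (hf : L.Mem f) (hg : L.Mem g) {S : Set ℝ}
    (hS : MeasurableSet S) :
    L.nrm (S.indicator f) ≤ L.nrm (S.indicator g) + L.nrm (S.indicator (f - g)) := by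
  have h : S.indicator f = S.indicator g + S.indicator (f - g) := by
    ext x
    by_cases hx : x ∈ S <;> simp [hx]
  conv_lhs => rw [h]
  exact (hg.indicator hS).nrm_add_le ((hf.sub hg).indicator hS)

end LatticeNorm

/-! ### Upper estimate for the approximation numbers -/

namespace BanachFunctionSpace

variable {a b : ℝ} {E : BanachFunctionSpace a b} {f g u v w p q : ℝ → ℝ}

/-- The approximant replaces the primitive on each cell by its value at the left end. What remains
there is `v x * ∫ s in t i..x, f s * u s`, of norm at most `ε ‖f χ_J‖` by Hölder's inequality; the
cellwise bound then gives the global estimate. -/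
theorem approximationNumber_hardy_le {D : ℝ} (hD0 : 0 ≤ D) (hD : E.CellwiseBound D)
    (hu : E.assocLat.Mem u) (hv : E.lat.Mem v) {t : ℕ → ℝ} {N n : ℕ} (ht : IsDivision a b t N)
    {ε : ℝ} (hε : 0 ≤ ε) (h : ∀ i < N, E.lat.nrm ((Ioo (t i) (t (i + 1))).indicator v) *
      E.assocLat.nrm ((Ioo (t i) (t (i + 1))).indicator u) ≤ ε) (hn : N < n) :
    approximationNumber n (hardy hu hv) ≤ ENNReal.ofReal (D * ε) := by
  classical
  have hvi : ∀ i, E.lat.Mem ((Ioo (t i) (t (i + 1))).indicator v) := fun i =>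
    hv.indicator measurableSet_Ioo
  let ℓ : ℕ → StrongDual ℝ E.Space := fun i => integralL hu (ht.left_le i) (ht.le_right i)
  let y : ℕ → E.Space := fun i => toSpace _ (hvi i)
  let P : E.Space →L[ℝ] E.Space := ∑ i ∈ Finset.range N, (ℓ i).smulRight (y i)
  have hPf : ∀ f, P f = ∑ i ∈ Finset.range N, ℓ i f • y i := fun f => by simp [P]
  have hrank : (P : E.Space →ₗ[ℝ] E.Space).rank < n := by
    have hsub : LinearMap.range (P : E.Space →ₗ[ℝ] E.Space) ≤
        Submodule.span ℝ ((Finset.range N).image y : Finset E.Space) := by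
      rintro _ ⟨f, rfl⟩
      change P f ∈ _
      rw [hPf]
      refine Submodule.sum_mem _ fun i hi => Submodule.smul_mem _ _ (Submodule.subset_span ?_)
      exact Finset.mem_coe.2 (Finset.mem_image_of_mem y hi)
    refine ((Submodule.rank_mono hsub).trans (rank_span_finset_le _)).trans_lt ?_
    have : ((Finset.range N).image y).card ≤ N := by
      simpa using Finset.card_image_le (s := Finset.range N) (f := y)
    exact_mod_cast this.trans_lt hn
  refine iInf_le_of_le P (iInf_le_of_le hrank ?_)
  rw [← ofReal_norm]
  refine ENNReal.ofReal_le_ofReal (ContinuousLinearMap.opNorm_le_bound _ (mul_nonneg hD0 hε) ?_)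
  intro f
  refine hD t N ht f ((hardy hu hv - P) f) (mem_coe f) (mem_coe _) ε hε fun i hi => ?_
  set J := Ioo (t i) (t (i + 1)) with hJ
  set c := E.lat.nrm (J.indicator f) * E.assocLat.nrm (J.indicator u) with hc
  have hc0 : 0 ≤ c := mul_nonneg (E.lat.nrm_nonneg _) (E.assocLat.nrm_nonneg _)
  have hall : ∀ᵐ x ∂lebesgueOn a b, ∀ j, (y j) x = (Ioo (t j) (t (j + 1))).indicator v x ∧
      (ℓ j f • y j : E.Space) x = ℓ j f * y j x :=
    ae_all_iff.2 fun j => (coe_toSpace (hvi j)).and (coe_smul (ℓ j f) (y j))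
  have hle : E.lat.nrm (J.indicator ((hardy hu hv - P) f)) ≤ E.lat.nrm (c • J.indicator v) := by
    refine ((hvi i).smul c).nrm_le ((mem_coe _).indicator measurableSet_Ioo).1 ?_
    filter_upwards [hall, coe_sum (Finset.range N) (fun i => ℓ i f • y i), coe_hardy hu hv f,
      coe_sub (hardy hu hv f) (P f)] with x h1 h2 h3 h4
    by_cases hx : x ∈ J
    · have hx' : x ∈ Ioo a b := ht.cell_subset i hx
      have h5 : P f x = v x * ∫ s in a..t i, f s * u s := by
        rw [hPf, h2, Finset.sum_eq_single i]
        · rw [(h1 i).2, (h1 i).1, indicator_of_mem hx, mul_comm]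
          rfl
        · intro j _ hji
          rw [(h1 j).2, (h1 j).1, indicator_of_notMem, mul_zero]
          exact disjoint_left.1 (ht.cell_disjoint hji.symm) hx
        · exact fun hni => absurd (Finset.mem_range.2 hi) hni
      have h6 : (hardy hu hv - P) f x = v x * ∫ s in t i..x, f s * u s := by
        have hint := integrable_mul (mem_coe f) hu
        change (hardy hu hv f - P f : E.Space) x = _
        rw [h4, h3, h5, ← mul_sub, intervalIntegral.integral_interval_sub_left]
        · exact intervalIntegrable_of_mem hint ⟨le_rfl, hx'.1.le.trans hx'.2.le⟩
            ⟨hx'.1.le, hx'.2.le⟩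
        · exact intervalIntegrable_of_mem hint ⟨le_rfl, hx'.1.le.trans hx'.2.le⟩
            ⟨ht.left_le i, ht.le_right i⟩
      rw [indicator_of_mem hx, h6, Pi.smul_apply, indicator_of_mem hx, smul_eq_mul, abs_mul,
        abs_mul, abs_of_nonneg hc0, mul_comm]
      refine mul_le_mul_of_nonneg_right ?_ (abs_nonneg _)
      refine (intervalIntegral.abs_integral_le_integral_abs hx.1.le).trans ?_
      refine (integral_abs_mul_interval_le (mem_coe f) hu (ht.left_le i) hx.1.le hx'.2.le).trans ?_
      have hsub : Ioo (t i) x ⊆ J := Ioo_subset_Ioo_right hx.2.le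
      exact mul_le_mul ((mem_coe f).nrm_indicator_mono measurableSet_Ioo measurableSet_Ioo hsub)
        (hu.nrm_indicator_mono measurableSet_Ioo measurableSet_Ioo hsub)
        (E.assocLat.nrm_nonneg _) (E.lat.nrm_nonneg _)
    · rw [indicator_of_notMem hx, abs_zero]
      exact abs_nonneg _
  refine hle.trans ?_
  rw [LatticeNorm.nrm_smul _ (hvi i).1, abs_of_nonneg hc0, hc]
  have := mul_le_mul_of_nonneg_left (h i hi) (E.lat.nrm_nonneg (J.indicator f))
  linarith

/-- Every continuous positive function is nearly constant on short intervals. -/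
theorem exists_doubling (hg : Continuous g) {θ : ℝ} (hθ : 0 < θ) (hgθ : ∀ x, θ ≤ g x) (a b : ℝ) :
    ∃ η > 0, ∀ x ∈ Icc a b, ∀ y ∈ Icc a b, |x - y| < η → g x ≤ 2 * g y := by
  have huc := isCompact_Icc (a := a) (b := b) |>.uniformContinuousOn_of_continuous hg.continuousOn
  -- Oscillation below the lower bound `θ` of `g` gives `g x < g y + θ ≤ 2 * g y`.
  obtain ⟨η, hη, H⟩ := Metric.uniformContinuousOn_iff.1 huc θ hθ
  refine ⟨η, hη, fun x hx y hy hxy => ?_⟩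
  have h1 := H x hx y hy hxy
  rw [Real.dist_eq] at h1
  linarith [(abs_lt.1 h1).2, hgθ y]

/-- Continuous positive functions `p`, `q` that approximate `u`, `v` with error at most `e`
and vary by a factor of at most `2` on intervals shorter than `η`. -/
structure IsApprox (E : BanachFunctionSpace a b) (u v p q : ℝ → ℝ) (e η : ℝ) : Prop where
  continuous_p : Continuous p
  continuous_q : Continuous q
  p_pos : ∀ x, 0 < p x
  q_pos : ∀ x, 0 < q x
  mem_p : E.assocLat.Mem p
  mem_q : E.lat.Mem q
  eta_pos : 0 < η
  p_le : ∀ x ∈ Icc a b, ∀ y ∈ Icc a b, |x - y| < η → p x ≤ 2 * p y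
  q_le : ∀ x ∈ Icc a b, ∀ y ∈ Icc a b, |x - y| < η → q x ≤ 2 * q y
  err_v_u : E.lat.nrm (v - q) * E.assocLat.nrm u ≤ e
  err_v_p : E.lat.nrm (v - q) * E.assocLat.nrm p ≤ e
  err_q_u : E.lat.nrm q * E.assocLat.nrm (u - p) ≤ e

theorem exists_isApprox (hAC : E.HasACNorm) (hAC' : E.AssocHasACNorm) (hu : E.assocLat.Mem u)
    (hv : E.lat.Mem v) (hu0 : ∀ᵐ x ∂lebesgueOn a b, 0 < u x)
    (hv0 : ∀ᵐ x ∂lebesgueOn a b, 0 < v x) {e : ℝ} (he : 0 < e) :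
    ∃ p q η, IsApprox E u v p q e η := by
  have hK : IsACNorm a b E.assocLat.Mem E.assocLat.ρ := fun f hf => hAC' f (memAssoc_iff.2 hf)
  set U := E.assocLat.nrm u with hU
  set V := E.lat.nrm v with hV
  have hU0 : 0 ≤ U := E.assocLat.nrm_nonneg _
  have hV0 : 0 ≤ V := E.lat.nrm_nonneg _
  -- From `δ ≤ 1` the norms of `p` and `q` are at most `U + 1` and `V + 1`, so all three error
  -- products are at most `δ * (U + V + 1) ≤ e`.
  set δ := min 1 (e / (U + V + 1)) with hδ
  have hδ0 : 0 < δ := lt_min one_pos (by positivity)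
  have hδ1 : δ ≤ 1 := min_le_left _ _
  have hδe : δ * (U + V + 1) ≤ e := by
    rw [← le_div_iff₀ (by positivity)]
    exact min_le_right _ _
  obtain ⟨p, hp, ⟨θ, hθ, hpθ⟩, hpm, hpe⟩ := hu.exists_continuous_approx hK hu0 hδ0
  obtain ⟨q, hq, ⟨θ', hθ', hqθ⟩, hqm, hqe⟩ := hv.exists_continuous_approx (K := E.lat) hAC hv0 hδ0
  obtain ⟨η, hη, hη'⟩ := exists_doubling hp hθ hpθ a b
  obtain ⟨ζ, hζ, hζ'⟩ := exists_doubling hq hθ' hqθ a b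
  have hpU : E.assocLat.nrm p ≤ U + 1 := by
    refine (hu.nrm_le_add (hu.sub hpm) hpm.1 (.of_forall fun x => ?_)).trans
      (by linarith)
    have := abs_sub (u x) (u x - p x)
    simpa using this
  have hqV : E.lat.nrm q ≤ V + 1 := by
    refine (hv.nrm_le_add (hv.sub hqm) hqm.1 (.of_forall fun x => ?_)).trans
      (by linarith)
    have := abs_sub (v x) (v x - q x)
    simpa using this
  refine ⟨p, q, min η ζ, hp, hq, fun x => hθ.trans_le (hpθ x), fun x => hθ'.trans_le (hqθ x), hpm,
    hqm, lt_min hη hζ, fun x hx y hy h => hη' x hx y hy (h.trans_le (min_le_left _ _)),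
    fun x hx y hy h => hζ' x hx y hy (h.trans_le (min_le_right _ _)), ?_, ?_, ?_⟩
  · exact (mul_le_mul_of_nonneg_right hqe hU0).trans (by nlinarith)
  · exact (mul_le_mul hqe hpU (E.assocLat.nrm_nonneg _) hδ0.le).trans (by nlinarith)
  · exact (mul_le_mul hqV hpe (E.assocLat.nrm_nonneg _) (by linarith)).trans (by nlinarith)

theorem IsApprox.abs_integral_sub_le {e η : ℝ} (h : IsApprox E u v p q e η) (hab : a ≤ b)
    (hu : E.assocLat.Mem u) (hv : E.lat.Mem v) :
    |(∫ x in a..b, p x * q x) - ∫ x in a..b, u x * v x| ≤ 2 * e := by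
  have conv : ∀ w : ℝ → ℝ, ∫ x in a..b, w x = ∫ x, w x ∂lebesgueOn a b := fun w => by
    rw [intervalIntegral.integral_of_le hab, integral_Ioc_eq_integral_Ioo]
  have hpq := integrable_mul h.mem_q h.mem_p
  have huv := integrable_mul hv hu
  have h1 := integrable_mul h.mem_q (hu.sub h.mem_p)
  have h2 := integrable_mul (hv.sub h.mem_q) hu
  have key : (∫ x in a..b, p x * q x) - ∫ x in a..b, u x * v x =
      -((∫ x, q x * (u - p) x ∂lebesgueOn a b) + ∫ x, (v - q) x * u x ∂lebesgueOn a b) := by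
    rw [conv, conv, ← integral_add h1 h2, ← integral_sub (by simpa only [mul_comm] using hpq)
      (by simpa only [mul_comm] using huv), ← integral_neg]
    refine integral_congr_ae (.of_forall fun x => ?_)
    simp only [Pi.sub_apply]
    ring
  rw [key, abs_neg]
  have h3 := (abs_integral_le_integral_abs (μ := lebesgueOn a b)).trans
    (integral_abs_mul_le h.mem_q (hu.sub h.mem_p))
  have h4 := (abs_integral_le_integral_abs (μ := lebesgueOn a b)).trans
    (integral_abs_mul_le (hv.sub h.mem_q) hu)
  refine (abs_add_le _ _).trans ?_
  linarith [h.err_q_u, h.err_v_u]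

/-- The Muckenhoupt condition with constant `M`, in terms of real numbers. -/
def MuckenhouptBound (E : BanachFunctionSpace a b) (M : ℝ) : Prop :=
  ∀ c d : ℝ, a ≤ c → c < d → d ≤ b →
    E.lat.nrm ((Ioo c d).indicator fun _ => 1) * E.assocLat.nrm ((Ioo c d).indicator fun _ => 1)
      ≤ M * (d - c)

theorem Muckenhoupt.exists_bound (h : E.Muckenhoupt) : ∃ M, 0 < M ∧ E.MuckenhouptBound M := by
  obtain ⟨C, hC, H⟩ := h
  refine ⟨C, hC, fun c d hac hcd hdb => ?_⟩
  have h1 := ENNReal.toReal_mono ENNReal.ofReal_ne_top (H c d hac hcd hdb)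
  rw [ENNReal.toReal_mul, ENNReal.toReal_mul, ENNReal.toReal_inv,
    ENNReal.toReal_ofReal (sub_pos.2 hcd).le, ENNReal.toReal_ofReal hC.le,
    inv_mul_le_iff₀ (sub_pos.2 hcd)] at h1
  rw [mul_comm C]
  exact h1

/-- Comparing `p` and `q` with their values at `c` costs a factor 4 in the product of the norms and
another 4 in the integral; in between stands the Muckenhoupt condition. -/
theorem IsApprox.local_upper {e η M : ℝ} (h : IsApprox E u v p q e η) (hM0 : 0 ≤ M)
    (hM : E.MuckenhouptBound M) {c d : ℝ} (hac : a ≤ c) (hcd : c < d) (hdb : d ≤ b)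
    (hη : d - c < η) :
    E.lat.nrm ((Ioo c d).indicator q) * E.assocLat.nrm ((Ioo c d).indicator p) ≤
      16 * M * ∫ x in c..d, p x * q x := by
  have hcI : c ∈ Icc a b := ⟨hac, hcd.le.trans hdb⟩
  have hxI : ∀ x ∈ Icc c d, x ∈ Icc a b := fun x hx => ⟨hac.trans hx.1, hx.2.trans hdb⟩
  have hxc : ∀ x ∈ Icc c d, |x - c| < η := fun x hx => by
    rw [abs_of_nonneg (sub_nonneg.2 hx.1)]
    linarith [hx.2]
  have hcx : ∀ x ∈ Icc c d, |c - x| < η := fun x hx => by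
    rw [abs_sub_comm]
    exact hxc x hx
  have hq : E.lat.nrm ((Ioo c d).indicator q) ≤
      2 * q c * E.lat.nrm ((Ioo c d).indicator fun _ => 1) := by
    refine LatticeNorm.nrm_indicator_le_of_abs_le h.mem_q.1 measurableSet_Ioo
      (by linarith [h.q_pos c]) fun x hx => ?_
    rw [abs_of_pos (h.q_pos x)]
    exact h.q_le x (hxI x (Ioo_subset_Icc_self hx)) c hcI (hxc x (Ioo_subset_Icc_self hx))
  have hp : E.assocLat.nrm ((Ioo c d).indicator p) ≤
      2 * p c * E.assocLat.nrm ((Ioo c d).indicator fun _ => 1) := by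
    refine LatticeNorm.nrm_indicator_le_of_abs_le h.mem_p.1 measurableSet_Ioo
      (by linarith [h.p_pos c]) fun x hx => ?_
    rw [abs_of_pos (h.p_pos x)]
    exact h.p_le x (hxI x (Ioo_subset_Icc_self hx)) c hcI (hxc x (Ioo_subset_Icc_self hx))
  have hint : (d - c) * (p c * q c / 4) ≤ ∫ x in c..d, p x * q x := by
    rw [← smul_eq_mul, ← intervalIntegral.integral_const]
    refine intervalIntegral.integral_mono_on hcd.le (by simp)
      ((h.continuous_p.mul h.continuous_q).intervalIntegrable _ _) fun x hx => ?_
    have h1 := h.p_le c hcI x (hxI x hx) (hcx x hx)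
    have h2 := h.q_le c hcI x (hxI x hx) (hcx x hx)
    have := mul_le_mul h1 h2 (h.q_pos c).le (by linarith [h.p_pos x])
    linarith
  have hpos : 0 < p c * q c := mul_pos (h.p_pos c) (h.q_pos c)
  calc _ ≤ 2 * q c * E.lat.nrm ((Ioo c d).indicator fun _ => 1) *
        (2 * p c * E.assocLat.nrm ((Ioo c d).indicator fun _ => 1)) :=
        mul_le_mul hq hp (E.assocLat.nrm_nonneg _)
          (mul_nonneg (by linarith [h.q_pos c]) (E.lat.nrm_nonneg _))
    _ = 4 * (p c * q c) * (E.lat.nrm ((Ioo c d).indicator fun _ => 1) *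
        E.assocLat.nrm ((Ioo c d).indicator fun _ => 1)) := by ring
    _ ≤ 4 * (p c * q c) * (M * (d - c)) :=
        mul_le_mul_of_nonneg_left (hM c d hac hcd hdb) (by positivity)
    _ = 16 * M * ((d - c) * (p c * q c / 4)) := by ring
    _ ≤ _ := mul_le_mul_of_nonneg_left hint (by positivity)

/-- On each cell, `‖v‖‖u‖' ≤ ‖q‖‖p‖' + ‖q‖‖u - p‖' + ‖v - q‖‖u‖'`. Over the cells the first terms
sum to at most `16 * M * ∫ p * q` by `local_upper`, and each family of error terms to at most `2 * D
* e` by `CellwiseBound.sum_le`. -/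
theorem IsApprox.card_short_mul_le {e η M D ε : ℝ} (h : IsApprox E u v p q e η) (hM0 : 0 ≤ M)
    (hM : E.MuckenhouptBound M) (hD0 : 0 ≤ D) (hD : E.CellwiseBound D) (hu : E.assocLat.Mem u)
    (hv : E.lat.Mem v) {t : ℕ → ℝ} {N : ℕ} (ht : IsDivision a b t N) (hε : 0 < ε) {S : Finset ℕ}
    (hS : S ⊆ Finset.range N) (hshort : ∀ i ∈ S, t (i + 1) - t i < η)
    (hlarge : ∀ i ∈ S, ε < E.lat.nrm ((Ioo (t i) (t (i + 1))).indicator v) *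
      E.assocLat.nrm ((Ioo (t i) (t (i + 1))).indicator u)) :
    S.card * ε ≤ 16 * M * (∫ x in a..b, p x * q x) + 4 * D * e := by
  have hsum1 := hD.sum_le ht h.mem_q (hu.sub h.mem_p)
  have hsum2 := hD.sum_le ht (hv.sub h.mem_q) hu
  have hlt : ∀ i ∈ S, t i < t (i + 1) := by
    intro i hi
    refine lt_of_le_of_ne (ht.mono i.le_succ) fun heq => ?_
    have := hlarge i hi
    rw [← heq, Ioo_self, indicator_empty, LatticeNorm.nrm_zero, zero_mul] at this
    exact absurd this hε.not_gt
  have hterm : ∀ i ∈ S, ε ≤ 16 * M * (∫ x in t i..t (i + 1), p x * q x) +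
      (E.lat.nrm ((Ioo (t i) (t (i + 1))).indicator q) *
        E.assocLat.nrm ((Ioo (t i) (t (i + 1))).indicator (u - p)) +
      E.lat.nrm ((Ioo (t i) (t (i + 1))).indicator (v - q)) *
        E.assocLat.nrm ((Ioo (t i) (t (i + 1))).indicator u)) := by
    intro i hi
    have h1 := h.local_upper hM0 hM (ht.left_le i) (hlt i hi) (ht.le_right (i + 1)) (hshort i hi)
    have h2 := hv.nrm_indicator_le_add h.mem_q (measurableSet_Ioo (a := t i) (b := t (i + 1)))
    have h3 := hu.nrm_indicator_le_add h.mem_p (measurableSet_Ioo (a := t i) (b := t (i + 1)))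
    have h4 := mul_le_mul_of_nonneg_right h2
      (E.assocLat.nrm_nonneg ((Ioo (t i) (t (i + 1))).indicator u))
    have h5 := mul_le_mul_of_nonneg_left h3
      (E.lat.nrm_nonneg ((Ioo (t i) (t (i + 1))).indicator q))
    linarith [hlarge i hi]
  have hnn : ∀ i, 0 ≤ ∫ x in t i..t (i + 1), p x * q x := fun i =>
    intervalIntegral.integral_nonneg (ht.mono i.le_succ) fun x _ =>
      mul_nonneg (h.p_pos x).le (h.q_pos x).le
  calc S.card * ε = ∑ i ∈ S, ε := by simp
    _ ≤ _ := Finset.sum_le_sum hterm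
    _ ≤ _ := Finset.sum_le_sum_of_subset_of_nonneg hS fun i _ _ => by
        have := hnn i
        exact add_nonneg (by positivity) (add_nonneg
          (mul_nonneg (E.lat.nrm_nonneg _) (E.assocLat.nrm_nonneg _))
          (mul_nonneg (E.lat.nrm_nonneg _) (E.assocLat.nrm_nonneg _)))
    _ ≤ 16 * M * (∫ x in a..b, p x * q x) + (2 * D * e + 2 * D * e) := by
        rw [Finset.sum_add_distrib, Finset.sum_add_distrib, ← Finset.mul_sum,
          ht.sum_integral (w := fun x => p x * q x) (h.continuous_p.mul h.continuous_q)]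
        gcongr
        · exact hsum1.trans (mul_le_mul_of_nonneg_left h.err_q_u (by positivity))
        · exact hsum2.trans (mul_le_mul_of_nonneg_left h.err_v_u (by positivity))
    _ = _ := by ring

/-- Uniform absolute continuity of the norm of `u` makes every sufficiently fine mesh admissible, so
a minimal division exists. -/
theorem exists_division_le (hab : a < b) (hAC' : E.AssocHasACNorm) (hu : E.assocLat.Mem u)
    (hv : E.lat.Mem v) {ε : ℝ} (hε : 0 < ε) :
    ∃ N t, IsDivision a b t N ∧ ∀ i < N, E.lat.nrm ((Ioo (t i) (t (i + 1))).indicator v) *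
      E.assocLat.nrm ((Ioo (t i) (t (i + 1))).indicator u) ≤ ε := by
  have hK : IsACNorm a b E.assocLat.Mem E.assocLat.ρ := fun f hf => hAC' f (memAssoc_iff.2 hf)
  have hV := E.lat.nrm_nonneg v
  obtain ⟨η, hη, H⟩ := hu.uniform_ac hK (show 0 < ε / (E.lat.nrm v + 1) by positivity)
  obtain ⟨N, t, ht, hmesh⟩ := IsDivision.exists_mesh_le hab hη
  refine ⟨N, t, ht, fun i _ => ?_⟩
  have h1 := H (Ioo (t i) (t (i + 1))) measurableSet_Ioo (ht.cell_subset i) (by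
    rw [Real.volume_Ioo]
    exact ENNReal.ofReal_le_ofReal (hmesh i))
  refine (mul_le_mul (hv.nrm_indicator_le measurableSet_Ioo) h1 (E.assocLat.nrm_nonneg _)
    hV).trans ?_
  rw [← mul_div_assoc, div_le_iff₀ (by positivity)]
  nlinarith

theorem eventually_approximationNumber_le (hab : a < b) {M D : ℝ} (hM0 : 0 ≤ M)
    (hM : E.MuckenhouptBound M) (hD0 : 0 ≤ D) (hD : E.CellwiseBound D) (hAC : E.HasACNorm)
    (hAC' : E.AssocHasACNorm) (hu : E.assocLat.Mem u)
    (hv : E.lat.Mem v) (hu0 : ∀ᵐ x ∂lebesgueOn a b, 0 < u x)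
    (hv0 : ∀ᵐ x ∂lebesgueOn a b, 0 < v x) (hI : 0 < ∫ x in a..b, u x * v x) :
    ∀ᶠ n : ℕ in atTop, (n : ℝ≥0∞) * approximationNumber n (hardy hu hv) ≤
      ENNReal.ofReal (4 * D * (24 * M + 1) * ∫ x in a..b, u x * v x) := by
  set I := ∫ x in a..b, u x * v x with hIdef
  -- With this error `e`, both `4 * D * e ≤ I` and `∫ p * q ≤ 3 / 2 * I`, so the count of short
  -- cells is governed by `(24 * M + 1) * I`.
  obtain ⟨p, q, η, h⟩ := exists_isApprox hAC hAC' hu hv hu0 hv0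
    (show 0 < I / (4 * (1 + D)) by positivity)
  have hW := (abs_le.1 (h.abs_integral_sub_le hab.le hu hv)).2
  have hDe : 4 * D * (I / (4 * (1 + D))) ≤ I := by
    rw [← mul_div_assoc, div_le_iff₀ (by positivity)]
    nlinarith
  have he : 2 * (I / (4 * (1 + D))) ≤ I / 2 := by
    rw [← mul_div_assoc, div_le_iff₀ (by positivity)]
    nlinarith
  have hη := h.eta_pos
  obtain ⟨n₀, hn₀⟩ := exists_nat_gt (4 * ((b - a) / η) + 2)
  filter_upwards [eventually_ge_atTop n₀, eventually_gt_atTop 0] with n hn hn0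
  have hn' : 4 * ((b - a) / η) + 2 < (n : ℝ) := hn₀.trans_le (by exact_mod_cast hn)
  have hnpos : (0 : ℝ) < n := by exact_mod_cast hn0
  -- Chosen so that at most `n / 4` double cells are short. With at most `(b - a) / η` long ones and
  -- one unpaired cell, `N ≤ n / 2 + 2 * (b - a) / η + 1`, which is below `n` by the choice of `n₀`.
  set ε := 4 * (24 * M + 1) * I / n with hεdef
  have hε : 0 < ε := by positivity
  obtain ⟨N, t, ht, htε, htmin⟩ := IsDivision.exists_minimal
    (fun c d => E.lat.nrm ((Ioo c d).indicator v) * E.assocLat.nrm ((Ioo c d).indicator u)) ε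
    (exists_division_le hab hAC' hu hv hε)
  -- Only the `N / 2` complete pairs are counted, split into long and short ones; minimality makes
  -- the product of the norms on each exceed `ε`.
  let Sl := (Finset.range (N / 2)).filter fun j => η ≤ t (2 * (j + 1)) - t (2 * j)
  let Ss := (Finset.range (N / 2)).filter fun j => ¬ η ≤ t (2 * (j + 1)) - t (2 * j)
  have hcard : (Sl.card : ℝ) + Ss.card = (N / 2 : ℕ) := by
    have := Finset.card_filter_add_card_filter_not (s := Finset.range (N / 2))
      (fun j => η ≤ t (2 * (j + 1)) - t (2 * j))
    rw [Finset.card_range] at this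
    exact_mod_cast this
  have hsub : Finset.range (N / 2) ⊆ Finset.range (N / 2 + 1) :=
    Finset.range_mono (Nat.le_succ _)
  have hl : Sl.card * η ≤ b - a := ht.double.card_long_mul_le
    ((Finset.filter_subset _ _).trans hsub) fun j hj => (Finset.mem_filter.1 hj).2
  have hs : Ss.card * ε ≤ 16 * M * (∫ x in a..b, p x * q x) + 4 * D * (I / (4 * (1 + D))) := by
    refine h.card_short_mul_le hM0 hM hD0 hD hu hv ht.double hε
      ((Finset.filter_subset _ _).trans hsub)
      (fun j hj => not_le.1 (Finset.mem_filter.1 hj).2) fun j hj => ?_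
    have hj' : j < N / 2 := Finset.mem_range.1 (Finset.mem_filter.1 hj).1
    exact htmin (2 * j) (by omega)
  have hl' : (Sl.card : ℝ) ≤ (b - a) / η := by
    rwa [le_div_iff₀ hη]
  have hs' : (Ss.card : ℝ) ≤ n / 4 := by
    have h1 : Ss.card * ε ≤ (24 * M + 1) * I := by nlinarith
    have h2 : (n : ℝ) / 4 * ε = (24 * M + 1) * I := by
      rw [hεdef]
      field_simp
    rw [← h2] at h1
    exact le_of_mul_le_mul_right h1 hε
  have hN : N < n := by
    have h1 : N ≤ 2 * (N / 2) + 1 := by omega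
    have h2 : (N : ℝ) ≤ 2 * (N / 2 : ℕ) + 1 := by exact_mod_cast h1
    have h3 : (N : ℝ) < n := by linarith
    exact_mod_cast h3
  have := approximationNumber_hardy_le hD0 hD hu hv ht hε.le htε hN
  calc (n : ℝ≥0∞) * approximationNumber n (hardy hu hv) ≤ n * ENNReal.ofReal (D * ε) := by gcongr
    _ = ENNReal.ofReal (n * (D * ε)) := by
        rw [ENNReal.ofReal_mul hnpos.le, ENNReal.ofReal_natCast]
    _ = _ := by
        congr 1
        rw [hεdef]
        field_simp

end BanachFunctionSpace

/-! ### Lower estimate for the isomorphism numbers -/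

theorem IsDivision.exists_equidistribution {a b : ℝ} (hab : a < b) {w : ℝ → ℝ}
    (hw : Continuous w) (hpos : ∀ x, 0 < w x) {N : ℕ} (hN : 0 < N) :
    ∃ t, IsDivision a b t N ∧
      ∀ i < N, ∫ x in t i..t (i + 1), w x = (∫ x in a..b, w x) / N := by
  have hint : ∀ c d, IntervalIntegrable w volume c d := fun c d => hw.intervalIntegrable c d
  set H : ℝ → ℝ := fun x => ∫ s in a..x, w s with hH
  have hsub : ∀ x y, H y - H x = ∫ s in x..y, w s := fun x y =>
    intervalIntegral.integral_interval_sub_left (hint _ _) (hint _ _)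
  have hmono : StrictMono H := fun x y hxy => by
    rw [← sub_pos, hsub]
    exact intervalIntegral.intervalIntegral_pos_of_pos (hint _ _) hpos hxy
  have hcont : Continuous H := intervalIntegral.continuous_primitive hint a
  have ha : H a = 0 := intervalIntegral.integral_same
  have hW : 0 < H b := ha ▸ hmono hab
  have hN' : (0 : ℝ) < N := by exact_mod_cast hN
  -- The nodes are preimages of equally spaced values under the strictly increasing primitive; `min
  -- i N` makes them constant from `N` on.
  have hex : ∀ i : ℕ, ∃ x ∈ Icc a b, H x = (min i N : ℕ) * (H b / N) := by
    intro i
    refine intermediate_value_Icc hab.le hcont.continuousOn ⟨?_, ?_⟩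
    · rw [ha]
      positivity
    · have h1 : ((min i N : ℕ) : ℝ) ≤ N := by exact_mod_cast min_le_right i N
      calc ((min i N : ℕ) : ℝ) * (H b / N) ≤ N * (H b / N) := by gcongr
        _ = H b := by field_simp
  choose t _ ht using hex
  refine ⟨t, ⟨fun i j hij => ?_, ?_, fun i hi => ?_⟩, fun i hi => ?_⟩
  · rw [← hmono.le_iff_le, ht, ht]
    gcongr
  · apply hmono.injective
    rw [ht, ha]
    simp
  · apply hmono.injective
    rw [ht, min_eq_right hi]
    field_simp
  · rw [← hsub, ht, ht, min_eq_left hi, min_eq_left hi.le]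
    push_cast
    ring

namespace BanachFunctionSpace

variable {a b : ℝ} {E : BanachFunctionSpace a b} {f g u v w p q : ℝ → ℝ}

theorem integral_eq_zero_of_le {c d x : ℝ} (hax : a ≤ x) (hxb : x ≤ b)
    (hsupp : ∀ y, y ∉ Ioo c d → w y = 0) (hxc : x ≤ c) : ∫ s in a..x, w s = 0 := by
  rw [integral_Ioo_lebesgueOn le_rfl hax hxb]
  refine (integral_congr_ae (.of_forall fun y => ?_)).trans (integral_zero ℝ ℝ)
  by_cases hy : y ∈ Ioo a x
  · rw [indicator_of_mem hy]
    exact hsupp y fun h => absurd h.1 (hy.2.le.trans hxc).not_gt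
  · rw [indicator_of_notMem hy]

theorem integral_eq_of_ge {c d x : ℝ} (hax : a ≤ x) (hxb : x ≤ b) (hac : a ≤ c)
    (hsupp : ∀ y, y ∉ Ioo c d → w y = 0) (hxd : d ≤ x) :
    ∫ s in a..x, w s = ∫ s, w s ∂lebesgueOn a b := by
  rw [integral_Ioo_lebesgueOn le_rfl hax hxb]
  refine integral_congr_ae (.of_forall fun y => ?_)
  by_cases hy : y ∈ Ioo a x
  · rw [indicator_of_mem hy]
  · rw [indicator_of_notMem hy, hsupp y fun h => hy ⟨hac.trans_lt h.1, h.2.trans_le hxd⟩]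

/-- A function supported in `(c, d)` with vanishing `u`-integral, whose primitive is `1` on an
inner interval. -/
theorem exists_bump (hu : E.assocLat.Mem u) (hu0 : ∀ᵐ x ∂lebesgueOn a b, 0 < u x)
    {c m₁ m₂ d r : ℝ} (hac : a ≤ c) (hcm : c < m₁) (hmm : m₁ < m₂) (hmd : m₂ < d) (hdb : d ≤ b)
    (hr : 0 < r) (hr₁ : r ≤ E.assocLat.nrm ((Ioo c m₁).indicator u))
    (hr₂ : r ≤ E.assocLat.nrm ((Ioo m₂ d).indicator u)) :
    ∃ f, E.lat.Mem f ∧ (∀ x, x ∉ Ioo c d → f x = 0) ∧ E.lat.nrm f ≤ 4 / r ∧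
      (∀ x ∈ Ioo a b, x ∉ Ioo c d → ∫ s in a..x, f s * u s = 0) ∧
      ∀ x ∈ Ioo m₁ m₂, ∫ s in a..x, f s * u s = 1 := by
  obtain ⟨f₁, hf₁, hf₁n, -, hf₁s, hf₁u⟩ := exists_nearly_norming hu (measurableSet_Ioo (a := c)
    (b := m₁))
  obtain ⟨f₂, hf₂, hf₂n, -, hf₂s, hf₂u⟩ := exists_nearly_norming hu (measurableSet_Ioo (a := m₂)
    (b := d))
  have habs : ∀ k : ℝ → ℝ, ∫ x, k x * |u x| ∂lebesgueOn a b = ∫ x, k x * u x ∂lebesgueOn a b :=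
    fun k => integral_congr_ae (hu0.mono fun x hx => by simp only [abs_of_pos hx])
  rw [habs] at hf₁u hf₂u
  set α := ∫ x, f₁ x * u x ∂lebesgueOn a b with hα
  set β := ∫ x, f₂ x * u x ∂lebesgueOn a b with hβ
  have hα0 : 0 < α := by linarith
  have hβ0 : 0 < β := by linarith
  have hs₁ : ∀ x, x ∉ Ioo c m₁ → f₁ x * u x = 0 := fun x hx => by rw [hf₁s x hx, zero_mul]
  have hs₂ : ∀ x, x ∉ Ioo m₂ d → f₂ x * u x = 0 := fun x hx => by rw [hf₂s x hx, zero_mul]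
  have hprim : ∀ x ∈ Ioo a b, ∫ s in a..x, (α⁻¹ • f₁ - β⁻¹ • f₂) s * u s =
      α⁻¹ * (∫ s in a..x, f₁ s * u s) - β⁻¹ * ∫ s in a..x, f₂ s * u s := by
    intro x hx
    have hi : ∀ k, E.lat.Mem k → IntervalIntegrable (fun s => k s * u s) volume a x :=
      fun k hk => intervalIntegrable_of_mem (integrable_mul hk hu)
        ⟨le_rfl, (hx.1.trans hx.2).le⟩ ⟨hx.1.le, hx.2.le⟩
    rw [← intervalIntegral.integral_const_mul, ← intervalIntegral.integral_const_mul,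
      ← intervalIntegral.integral_sub ((hi f₁ hf₁).const_mul _) ((hi f₂ hf₂).const_mul _)]
    refine intervalIntegral.integral_congr fun s _ => ?_
    simp only [Pi.sub_apply, Pi.smul_apply, smul_eq_mul]
    ring
  -- The first term raises the primitive to `1` before `m₁`, the second returns it to `0` after
  -- `m₂`. Since `α` and `β` are at least `r / 2`, each term has norm at most `2 / r`.
  refine ⟨α⁻¹ • f₁ - β⁻¹ • f₂, (hf₁.smul _).sub (hf₂.smul _), fun x hx => ?_, ?_, fun x hx hxJ => ?_,
    fun x hx => ?_⟩
  · have h1 : x ∉ Ioo c m₁ := fun h => hx ⟨h.1, by linarith [h.2]⟩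
    have h2 : x ∉ Ioo m₂ d := fun h => hx ⟨by linarith [h.1], h.2⟩
    simp [hf₁s x h1, hf₂s x h2]
  · have h1 : E.lat.nrm (α⁻¹ • f₁ - β⁻¹ • f₂) ≤ E.lat.nrm (α⁻¹ • f₁) + E.lat.nrm (β⁻¹ • f₂) :=
      (hf₁.smul _).nrm_le_add (hf₂.smul _) ((hf₁.smul _).sub (hf₂.smul _)).1
        (.of_forall fun x => abs_sub _ _)
    rw [LatticeNorm.nrm_smul _ hf₁.1, LatticeNorm.nrm_smul _ hf₂.1, abs_of_pos (inv_pos.2 hα0),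
      abs_of_pos (inv_pos.2 hβ0)] at h1
    have h2 : ∀ γ, r / 2 ≤ γ → γ⁻¹ ≤ 2 / r := fun γ hγ => by
      rw [← inv_div]
      exact inv_anti₀ (by positivity) hγ
    have h3 := mul_le_mul (h2 α (by linarith)) hf₁n (E.lat.nrm_nonneg _) (by positivity)
    have h4 := mul_le_mul (h2 β (by linarith)) hf₂n (E.lat.nrm_nonneg _) (by positivity)
    have h5 : 4 / r = 2 / r * 1 + 2 / r * 1 := by ring
    linarith
  · rw [hprim x hx]
    rcases le_or_gt x c with h | h
    · rw [integral_eq_zero_of_le hx.1.le hx.2.le hs₁ h,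
        integral_eq_zero_of_le hx.1.le hx.2.le hs₂ (by linarith), mul_zero, mul_zero, sub_zero]
    · have hdx : d ≤ x := not_lt.1 fun hlt => hxJ ⟨h, hlt⟩
      rw [integral_eq_of_ge hx.1.le hx.2.le hac hs₁ (by linarith),
        integral_eq_of_ge hx.1.le hx.2.le (by linarith) hs₂ hdx, inv_mul_cancel₀ hα0.ne',
        inv_mul_cancel₀ hβ0.ne', sub_self]
  · have hx' : x ∈ Ioo a b := ⟨by linarith [hx.1], by linarith [hx.2]⟩
    rw [hprim x hx', integral_eq_of_ge hx'.1.le hx'.2.le hac hs₁ hx.1.le,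
      integral_eq_zero_of_le hx'.1.le hx'.2.le hs₂ hx.2.le, mul_zero, sub_zero,
      inv_mul_cancel₀ hα0.ne']

/-- The images `T (f i)` live on disjoint cells, so restricting to a cell and applying a functional
that norms `T (f i)` gives a system biorthogonal to them. The norm of `x ↦ ∑ G i x • F i` is bounded
cell by cell, then globally by the cellwise bound. -/
theorem le_isomorphismNumber_hardy {D : ℝ} (hD0 : 0 < D) (hD : E.CellwiseBound D)
    (hu : E.assocLat.Mem u) (hv : E.lat.Mem v) {t : ℕ → ℝ} {N : ℕ} (ht : IsDivision a b t N)
    {κ : ℝ} (hκ : 0 < κ) (S : Finset ℕ)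
    (h : ∀ i ∈ S, ∃ f, E.lat.Mem f ∧ (∀ x, x ∉ Ioo (t i) (t (i + 1)) → f x = 0) ∧
      (∀ x ∈ Ioo a b, x ∉ Ioo (t i) (t (i + 1)) → ∫ s in a..x, f s * u s = 0) ∧
      0 < E.lat.nrm (fun x => v x * ∫ s in a..x, f s * u s) ∧
      E.lat.nrm f ≤ κ * E.lat.nrm (fun x => v x * ∫ s in a..x, f s * u s)) :
    ENNReal.ofReal (D * κ)⁻¹ ≤ isomorphismNumber S.card (hardy hu hv) := by
  classical
  choose! f hf hfs hfi hpos hle using h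
  let F : S → E.Space := fun i => toSpace (f i) (hf i i.2)
  have hF : ∀ i : S, (F i : ℝ → ℝ) =ᵐ[lebesgueOn a b] f i := fun i => coe_toSpace (hf i i.2)
  have hTF : ∀ i : S, (hardy hu hv (F i) : ℝ → ℝ) =ᵐ[lebesgueOn a b]
      fun x => v x * ∫ s in a..x, f i s * u s := by
    intro i
    filter_upwards [coe_hardy hu hv (F i), ae_restrict_mem measurableSet_Ioo] with x hx hxI
    rw [hx]
    congr 1
    exact integral_congr_lebesgueOn le_rfl hxI.1.le hxI.2.le
      ((hF i).mono fun y hy => by simp only [hy])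
  have hTn : ∀ i : S, ‖hardy hu hv (F i)‖ =
      E.lat.nrm (fun x => v x * ∫ s in a..x, f i s * u s) := fun i =>
    LatticeNorm.nrm_congr (L := E.lat) (hardy_mem_and_nrm_le hu hv (hf i i.2)).1.1 (hTF i)
  choose k hk hky using fun i : S => exists_dual_vector'' ℝ (hardy hu hv (F i))
  let R : S → E.Space →L[ℝ] E.Space := fun i =>
    E.restrictL (Ioo (t i) (t (i + 1))) measurableSet_Ioo
  let G : S → StrongDual ℝ E.Space := fun i => ‖hardy hu hv (F i)‖⁻¹ • (k i).comp (R i)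
  have hG : ∀ i x, G i x = ‖hardy hu hv (F i)‖⁻¹ * k i (R i x) := fun i x => rfl
  have hnpos : ∀ i : S, 0 < ‖hardy hu hv (F i)‖ := fun i => by
    rw [hTn]
    exact hpos i i.2
  rw [← Fintype.card_coe S]
  refine le_isomorphismNumber (hardy hu hv) F G (fun i => ?_) (fun i j hij => ?_)
    (mul_pos hD0 hκ) fun x => ?_
  · have hR : R i (hardy hu hv (F i)) = hardy hu hv (F i) := space_ext <| by
      filter_upwards [coe_restrictL (E := E) (measurableSet_Ioo (a := t i) (b := t (i + 1)))
        (hardy hu hv (F i)), hTF i, ae_restrict_mem measurableSet_Ioo] with x h1 h2 hx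
      rw [h1]
      by_cases hxJ : x ∈ Ioo (t i) (t (i + 1))
      · rw [indicator_of_mem hxJ]
      · rw [indicator_of_notMem hxJ, h2, hfi i i.2 x hx hxJ, mul_zero]
    rw [hG, hR, hky]
    exact inv_mul_cancel₀ (hnpos i).ne'
  · have hR : R i (hardy hu hv (F j)) = 0 := space_ext <| by
      filter_upwards [coe_restrictL (E := E) (measurableSet_Ioo (a := t i) (b := t (i + 1)))
        (hardy hu hv (F j)), hTF j, ae_restrict_mem measurableSet_Ioo, coe_zero (E := E)] with
        x h1 h2 hx h0
      rw [h1, h0]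
      by_cases hxJ : x ∈ Ioo (t i) (t (i + 1))
      · have hxJ' : x ∉ Ioo (t j) (t (j + 1)) :=
          disjoint_left.1 (ht.cell_disjoint fun h => hij (Subtype.ext h)) hxJ
        rw [indicator_of_mem hxJ, h2, hfi j j.2 x hx hxJ', mul_zero]
      · rw [indicator_of_notMem hxJ]
    rw [hG, hR, map_zero, mul_zero]
  -- On a cell of `S` the sum is one term of norm at most `‖T (F i)‖⁻¹ ‖x χ_J‖ * κ ‖T (F i)‖`; on
  -- any other cell it vanishes.
  · refine hD t N ht x (∑ i, G i x • F i : E.Space) (mem_coe x) (mem_coe _) κ hκ.le fun i _ => ?_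
    have hall : ∀ᵐ y ∂lebesgueOn a b, ∀ j : S, F j y = f j y ∧
        (G j x • F j : E.Space) y = G j x * F j y :=
      ae_all_iff.2 fun j => (hF j).and (coe_smul _ _)
    by_cases hi : i ∈ S
    · have h1 : (Ioo (t i) (t (i + 1))).indicator (∑ i, G i x • F i : E.Space)
          =ᵐ[lebesgueOn a b] G ⟨i, hi⟩ x • (Ioo (t i) (t (i + 1))).indicator (f i) := by
        filter_upwards [hall, coe_sum Finset.univ fun i => G i x • F i] with y h2 h3
        by_cases hy : y ∈ Ioo (t i) (t (i + 1))
        · rw [indicator_of_mem hy, h3, Finset.sum_eq_single ⟨i, hi⟩, (h2 _).2, (h2 _).1,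
            Pi.smul_apply, indicator_of_mem hy, smul_eq_mul]
          · intro j _ hj
            rw [(h2 j).2, (h2 j).1, hfs j j.2 y, mul_zero]
            exact disjoint_left.1 (ht.cell_disjoint fun h => hj (Subtype.ext h.symm)) hy
          · simp
        · rw [indicator_of_notMem hy, Pi.smul_apply, indicator_of_notMem hy, smul_zero]
      have hm := (hf i hi).indicator (measurableSet_Ioo (a := t i) (b := t (i + 1)))
      rw [LatticeNorm.nrm_congr (hm.smul _).1 h1, LatticeNorm.nrm_smul _ hm.1]
      have h4 : |G ⟨i, hi⟩ x| ≤ ‖hardy hu hv (F ⟨i, hi⟩)‖⁻¹ *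
          E.lat.nrm ((Ioo (t i) (t (i + 1))).indicator x) := by
        rw [hG, abs_mul, abs_of_pos (inv_pos.2 (hnpos _))]
        gcongr
        refine ((k ⟨i, hi⟩).le_opNorm _).trans ?_
        rw [norm_restrictL]
        exact mul_le_of_le_one_left (E.lat.nrm_nonneg _) (hk _)
      have h5 := ((hf i hi).nrm_indicator_le (measurableSet_Ioo (a := t i)
        (b := t (i + 1)))).trans (hle i hi)
      rw [← hTn ⟨i, hi⟩] at h5
      refine (mul_le_mul h4 h5 (E.lat.nrm_nonneg _) (mul_nonneg (inv_nonneg.2 (norm_nonneg _))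
        (E.lat.nrm_nonneg _))).trans (le_of_eq ?_)
      have := (hnpos ⟨i, hi⟩).ne'
      field_simp
    · have h1 : (Ioo (t i) (t (i + 1))).indicator (∑ i, G i x • F i : E.Space)
          =ᵐ[lebesgueOn a b] (0 : ℝ) • fun _ => (0 : ℝ) := by
        filter_upwards [hall, coe_sum Finset.univ fun i => G i x • F i] with y h2 h3
        by_cases hy : y ∈ Ioo (t i) (t (i + 1))
        · rw [indicator_of_mem hy, h3, Pi.smul_apply, zero_smul]
          refine Finset.sum_eq_zero fun j _ => ?_
          rw [(h2 j).2, (h2 j).1, hfs j j.2 y, mul_zero]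
          exact disjoint_left.1 (ht.cell_disjoint fun h => hi (by rw [h]; exact j.2)) hy
        · rw [indicator_of_notMem hy, Pi.smul_apply, zero_smul]
      rw [LatticeNorm.nrm_congr ((LatticeNorm.mem_const (L := E.lat) 0).smul 0).1 h1,
        LatticeNorm.nrm_smul _ aestronglyMeasurable_const, abs_zero, zero_mul]
      exact mul_nonneg hκ.le (E.lat.nrm_nonneg _)

/-- Hölder's inequality for the constant `1`: the converse of the Muckenhoupt bound, valid with
constant `1`. -/
theorem sub_le_nrm_mul_nrm {c d : ℝ} (hac : a ≤ c) (hcd : c ≤ d) (hdb : d ≤ b) :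
    d - c ≤ E.lat.nrm ((Ioo c d).indicator fun _ => 1) *
      E.assocLat.nrm ((Ioo c d).indicator fun _ => 1) := by
  have := integral_abs_mul_interval_le (E := E) LatticeNorm.mem_one LatticeNorm.mem_one hac hcd hdb
  simpa using this

/-- On a short interval, either there is a function on which the Hardy operator is large, or the
approximation of the weights is bad. -/
theorem IsApprox.local_lower {e η M : ℝ} (h : IsApprox E u v p q e η) (hM0 : 0 < M)
    (hM : E.MuckenhouptBound M) (hu : E.assocLat.Mem u) (hv : E.lat.Mem v)
    (hu0 : ∀ᵐ x ∂lebesgueOn a b, 0 < u x) {c d : ℝ} (hac : a ≤ c) (hcd : c < d) (hdb : d ≤ b)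
    (hη : d - c < η) :
    (∃ f, E.lat.Mem f ∧ (∀ x, x ∉ Ioo c d → f x = 0) ∧
      (∀ x ∈ Ioo a b, x ∉ Ioo c d → ∫ s in a..x, f s * u s = 0) ∧
      0 < E.lat.nrm (fun x => v x * ∫ s in a..x, f s * u s) ∧
      E.lat.nrm f ≤ 2304 * M / (∫ x in c..d, p x * q x) *
        E.lat.nrm (fun x => v x * ∫ s in a..x, f s * u s)) ∨
    (∫ x in c..d, p x * q x) / 96 ≤
      E.lat.nrm ((Ioo c d).indicator (v - q)) * E.assocLat.nrm ((Ioo c d).indicator p) +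
      E.lat.nrm ((Ioo c d).indicator q) * E.assocLat.nrm ((Ioo c d).indicator (u - p)) := by
  have hcI : c ∈ Icc a b := ⟨hac, hcd.le.trans hdb⟩
  have hxI : ∀ x ∈ Icc c d, x ∈ Icc a b := fun x hx => ⟨hac.trans hx.1, hx.2.trans hdb⟩
  have hxc : ∀ x ∈ Icc c d, |x - c| < η := fun x hx => by
    rw [abs_of_nonneg (sub_nonneg.2 hx.1)]
    linarith [hx.2]
  have hcx : ∀ x ∈ Icc c d, |c - x| < η := fun x hx => by
    rw [abs_sub_comm]
    exact hxc x hx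
  set P := p c with hP
  set Q := q c with hQ
  have hP0 : 0 < P := h.p_pos c
  have hQ0 : 0 < Q := h.q_pos c
  set ℓ := d - c with hℓ
  have hℓ0 : 0 < ℓ := sub_pos.2 hcd
  set X := E.lat.nrm ((Ioo c d).indicator fun _ => 1) with hX
  set Y := E.assocLat.nrm ((Ioo c d).indicator fun _ => 1) with hY
  set A := E.lat.nrm ((Ioo c d).indicator (v - q)) with hA
  set B := E.assocLat.nrm ((Ioo c d).indicator (u - p)) with hB
  have hXY : X * Y ≤ M * ℓ := hM c d hac hcd hdb
  have hXY' : ℓ ≤ X * Y := sub_le_nrm_mul_nrm hac hcd.le hdb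
  have hXYpos : 0 < X * Y := hℓ0.trans_le hXY'
  have hX0 : 0 < X := pos_of_mul_pos_left hXYpos (E.assocLat.nrm_nonneg _)
  have hY0 : 0 < Y := pos_of_mul_pos_right hXYpos (E.lat.nrm_nonneg _)
  set W := ∫ x in c..d, p x * q x with hW
  have hWpos : 0 < W := intervalIntegral.intervalIntegral_pos_of_pos
    ((h.continuous_p.mul h.continuous_q).intervalIntegrable _ _)
    (fun x => mul_pos (h.p_pos x) (h.q_pos x)) hcd
  have hWle : W ≤ 4 * (P * Q * ℓ) := by
    have : W ≤ (d - c) * (4 * (P * Q)) := by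
      rw [← smul_eq_mul, ← intervalIntegral.integral_const]
      refine intervalIntegral.integral_mono_on hcd.le
        ((h.continuous_p.mul h.continuous_q).intervalIntegrable _ _) (by simp) fun x hx => ?_
      have h1 := h.p_le x (hxI x hx) c hcI (hxc x hx)
      have h2 := h.q_le x (hxI x hx) c hcI (hxc x hx)
      have := mul_le_mul h1 h2 (h.q_pos x).le (by linarith [h.p_pos c])
      linarith
    linarith
  have hqlow : ∀ x ∈ Ioo c d, Q / 2 ≤ |q x| := fun x hx => by
    have := h.q_le c hcI x (hxI x (Ioo_subset_Icc_self hx)) (hcx x (Ioo_subset_Icc_self hx))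
    rw [abs_of_pos (h.q_pos x)]
    linarith
  have hplow : ∀ x ∈ Ioo c d, P / 2 ≤ |p x| := fun x hx => by
    have := h.p_le c hcI x (hxI x (Ioo_subset_Icc_self hx)) (hcx x (Ioo_subset_Icc_self hx))
    rw [abs_of_pos (h.p_pos x)]
    linarith
  -- If the error of `v` or of `u` is large on the cell, the corresponding product exceeds `P * Q *
  -- ℓ / 24`, which is at least `W / 96`.
  by_cases hbadv : Q * ℓ < 12 * Y * A
  · right
    have h1 := h.mem_p.le_nrm_indicator measurableSet_Ioo (by positivity) hplow
    have h2 : A * (P / 2 * Y) ≤ A * E.assocLat.nrm ((Ioo c d).indicator p) :=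
      mul_le_mul_of_nonneg_left h1 (E.lat.nrm_nonneg _)
    have h3 : 0 ≤ E.lat.nrm ((Ioo c d).indicator q) * B :=
      mul_nonneg (E.lat.nrm_nonneg _) (E.assocLat.nrm_nonneg _)
    have h4 := mul_lt_mul_of_pos_left hbadv hP0
    linarith
  by_cases hbadu : P * ℓ < 12 * X * B
  · right
    have h1 := h.mem_q.le_nrm_indicator measurableSet_Ioo (by positivity) hqlow
    have h2 : (Q / 2 * X) * B ≤ E.lat.nrm ((Ioo c d).indicator q) * B :=
      mul_le_mul_of_nonneg_right h1 (E.assocLat.nrm_nonneg _)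
    have h3 : 0 ≤ A * E.assocLat.nrm ((Ioo c d).indicator p) :=
      mul_nonneg (E.lat.nrm_nonneg _) (E.assocLat.nrm_nonneg _)
    have h4 := mul_lt_mul_of_pos_left hbadu hQ0
    linarith
  left
  rw [not_lt] at hbadv hbadu
  -- The cell is cut into thirds: the outer two carry the bump, and on the middle one its primitive
  -- equals `1`. Hölder on a third bounds either norm of its characteristic function from below by
  -- `ℓ / 3` over the other norm on the whole cell.
  have hthird : ∀ c' d', c ≤ c' → d' ≤ d → d' - c' = ℓ / 3 →
      ℓ / 3 ≤ E.lat.nrm ((Ioo c' d').indicator fun _ => 1) * Y ∧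
      ℓ / 3 ≤ X * E.assocLat.nrm ((Ioo c' d').indicator fun _ => 1) := by
    intro c' d' hc' hd' hcd'
    have h1 := sub_le_nrm_mul_nrm (E := E) (hac.trans hc') (by linarith : c' ≤ d')
      (hd'.trans hdb)
    rw [hcd'] at h1
    have hsub : Ioo c' d' ⊆ Ioo c d := Ioo_subset_Ioo hc' hd'
    have h2 := (LatticeNorm.mem_one (L := E.lat)).nrm_indicator_mono measurableSet_Ioo
      measurableSet_Ioo hsub
    have h3 := (LatticeNorm.mem_one (L := E.assocLat)).nrm_indicator_mono measurableSet_Ioo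
      measurableSet_Ioo hsub
    exact ⟨h1.trans (mul_le_mul_of_nonneg_left h3 (E.lat.nrm_nonneg _)),
      h1.trans (mul_le_mul_of_nonneg_right h2 (E.assocLat.nrm_nonneg _))⟩
  -- The norm of `p` on a third is at least `P * ℓ / (6 * X)`, and the error `B` consumes at most
  -- half of this.
  have hulow : ∀ c' d', c ≤ c' → d' ≤ d → d' - c' = ℓ / 3 →
      P * ℓ / (12 * X) ≤ E.assocLat.nrm ((Ioo c' d').indicator u) := by
    intro c' d' hc' hd' hcd'
    have hsub : Ioo c' d' ⊆ Ioo c d := Ioo_subset_Ioo hc' hd'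
    have h1 := h.mem_p.le_nrm_indicator (measurableSet_Ioo (a := c') (b := d')) (m := P / 2)
      (by positivity) fun x hx => hplow x (hsub hx)
    have h2 := h.mem_p.nrm_indicator_le_add hu (measurableSet_Ioo (a := c') (b := d'))
    have h3 : E.assocLat.nrm ((Ioo c' d').indicator (p - u)) ≤ B :=
      ((hu.sub h.mem_p).indicator measurableSet_Ioo).nrm_le
        ((h.mem_p.sub hu).indicator measurableSet_Ioo).1 (.of_forall fun x => by
          by_cases hx : x ∈ Ioo c' d'
          · rw [indicator_of_mem hx, indicator_of_mem (hsub hx), Pi.sub_apply, Pi.sub_apply,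
              abs_sub_comm]
          · rw [indicator_of_notMem hx, abs_zero]
            exact abs_nonneg _)
    have h4 := (hthird c' d' hc' hd' hcd').2
    rw [div_le_iff₀ (by positivity)]
    have h5 := mul_le_mul_of_nonneg_left h4 hP0.le
    have h6 := mul_le_mul_of_nonneg_left ((h1.trans h2).trans (add_le_add_right h3 _)) hX0.le
    linarith
  have hvlow : Q * ℓ / (12 * Y) ≤
      E.lat.nrm ((Ioo (c + ℓ / 3) (c + 2 * ℓ / 3)).indicator v) := by
    have hsub : Ioo (c + ℓ / 3) (c + 2 * ℓ / 3) ⊆ Ioo c d :=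
      Ioo_subset_Ioo (by linarith) (by linarith)
    have h1 := h.mem_q.le_nrm_indicator (measurableSet_Ioo (a := c + ℓ / 3) (b := c + 2 * ℓ / 3))
      (m := Q / 2) (by positivity) fun x hx => hqlow x (hsub hx)
    have h2 := h.mem_q.nrm_indicator_le_add hv
      (measurableSet_Ioo (a := c + ℓ / 3) (b := c + 2 * ℓ / 3))
    have h3 : E.lat.nrm ((Ioo (c + ℓ / 3) (c + 2 * ℓ / 3)).indicator (q - v)) ≤ A :=
      ((hv.sub h.mem_q).indicator measurableSet_Ioo).nrm_le
        ((h.mem_q.sub hv).indicator measurableSet_Ioo).1 (.of_forall fun x => by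
          by_cases hx : x ∈ Ioo (c + ℓ / 3) (c + 2 * ℓ / 3)
          · rw [indicator_of_mem hx, indicator_of_mem (hsub hx), Pi.sub_apply, Pi.sub_apply,
              abs_sub_comm]
          · rw [indicator_of_notMem hx, abs_zero]
            exact abs_nonneg _)
    have h4 := (hthird (c + ℓ / 3) (c + 2 * ℓ / 3) (by linarith) (by linarith) (by ring)).1
    rw [div_le_iff₀ (by positivity)]
    have h5 := mul_le_mul_of_nonneg_left h4 hQ0.le
    have h6 := mul_le_mul_of_nonneg_left ((h1.trans h2).trans (add_le_add_right h3 _)) hY0.le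
    linarith
  obtain ⟨f, hf, hfs, hfn, hf0, hf1⟩ := exists_bump hu hu0 (c := c) (m₁ := c + ℓ / 3)
    (m₂ := c + 2 * ℓ / 3) (d := d) hac (by linarith) (by linarith) (by linarith) hdb
    (show 0 < P * ℓ / (12 * X) by positivity)
    (hulow c (c + ℓ / 3) le_rfl (by linarith) (by ring))
    (hulow (c + 2 * ℓ / 3) d (by linarith) le_rfl (by rw [hℓ]; ring))
  have hHf := (hardy_mem_and_nrm_le hu hv hf).1
  have hbig : Q * ℓ / (12 * Y) ≤ E.lat.nrm (fun x => v x * ∫ s in a..x, f s * u s) := by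
    refine hvlow.trans (hHf.nrm_le (hv.indicator measurableSet_Ioo).1 (.of_forall fun x => ?_))
    by_cases hx : x ∈ Ioo (c + ℓ / 3) (c + 2 * ℓ / 3)
    · rw [indicator_of_mem hx, hf1 x hx, mul_one]
    · rw [indicator_of_notMem hx, abs_zero]
      exact abs_nonneg _
  refine ⟨f, hf, hfs, hf0, lt_of_lt_of_le (by positivity) hbig, hfn.trans ?_⟩
  refine le_trans ?_ (mul_le_mul_of_nonneg_left hbig (by positivity))
  have h1 : 4 / (P * ℓ / (12 * X)) = 48 * X / (P * ℓ) := by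
    field_simp
    norm_num
  have h2 : 2304 * M / W * (Q * ℓ / (12 * Y)) = 192 * M * Q * ℓ / (W * Y) := by
    field_simp
    norm_num
  -- The quotient of the two bounds is `576 * X * Y / (P * Q * ℓ ^ 2)`; `X * Y ≤ M * ℓ` and `W ≤ 4 *
  -- P * Q * ℓ` turn it into `2304 * M / W`.
  rw [h1, h2, div_le_div_iff₀ (by positivity) (by positivity)]
  calc 48 * X * (W * Y) = 48 * (X * Y) * W := by ring
    _ ≤ 48 * (M * ℓ) * (4 * (P * Q * ℓ)) := by gcongr
    _ = _ := by ring

theorem eventually_le_isomorphismNumber (hab : a < b) {M D : ℝ} (hM0 : 0 < M)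
    (hM : E.MuckenhouptBound M) (hD0 : 0 < D) (hD : E.CellwiseBound D) (hAC : E.HasACNorm)
    (hAC' : E.AssocHasACNorm) (hu : E.assocLat.Mem u)
    (hv : E.lat.Mem v) (hu0 : ∀ᵐ x ∂lebesgueOn a b, 0 < u x)
    (hv0 : ∀ᵐ x ∂lebesgueOn a b, 0 < v x) (hI : 0 < ∫ x in a..b, u x * v x) :
    ∀ᶠ n : ℕ in atTop, ENNReal.ofReal ((9216 * D * M)⁻¹ * ∫ x in a..b, u x * v x) ≤
      (n : ℝ≥0∞) * isomorphismNumber n (hardy hu hv) := by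
  set I := ∫ x in a..b, u x * v x with hIdef
  -- Small enough for `W ≥ I / 2` and for `4 * D * e ≤ W / 384`; the latter leaves at most `n / 2`
  -- bad short cells.
  set e := I / (4000 * (1 + D)) with he
  have he0 : 0 < e := by positivity
  obtain ⟨p, q, η, h⟩ := exists_isApprox hAC hAC' hu hv hu0 hv0 he0
  have hDe : 4000 * (D * e) + 4000 * e = I := by
    rw [he]
    field_simp
    ring
  have hDe0 : 0 < D * e := mul_pos hD0 he0
  set W := ∫ x in a..b, p x * q x with hWdef
  have hW := (abs_le.1 (h.abs_integral_sub_le hab.le hu hv)).1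
  have hWI : I / 2 ≤ W := by linarith
  have hWpos : 0 < W := by linarith
  have hη := h.eta_pos
  obtain ⟨n₀, hn₀⟩ := exists_nat_gt (2 * ((b - a) / η))
  filter_upwards [eventually_ge_atTop n₀, eventually_gt_atTop 0] with n hn hn0
  have hn' : 2 * ((b - a) / η) < (n : ℝ) := hn₀.trans_le (by exact_mod_cast hn)
  have hnpos : (0 : ℝ) < n := by exact_mod_cast hn0
  -- There are `2 * n` cells: fewer than `n / 2` are long and at most `n / 2` are short and bad, so
  -- at least `n` good ones remain.
  obtain ⟨t, ht, htW⟩ := IsDivision.exists_equidistribution hab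
    (h.continuous_p.mul h.continuous_q) (fun x => mul_pos (h.p_pos x) (h.q_pos x))
    (show 0 < 2 * n by omega)
  replace htW : ∀ i < 2 * n, ∫ x in t i..t (i + 1), p x * q x = W / (2 * n) := fun i hi => by
    have := htW i hi
    push_cast at this
    exact this
  have hlt : ∀ i < 2 * n, t i < t (i + 1) := by
    intro i hi
    refine lt_of_le_of_ne (ht.mono i.le_succ) fun heq => ?_
    have h1 := htW i hi
    rw [← heq, intervalIntegral.integral_same] at h1
    have h2 : 0 < W / (2 * n) := by positivity
    linarith
  -- This is `2304 * M` over the share `W / (2 * n)` of one cell, with `W` replaced by its lower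
  -- bound `I / 2`.
  let κ := 9216 * M * n / I
  have hκ : 0 < κ := by positivity
  have hκ' : 2304 * M / (W / (2 * n)) ≤ κ := by
    rw [div_div_eq_mul_div, div_le_div_iff₀ hWpos hI]
    have := mul_le_mul_of_nonneg_left hWI (show 0 ≤ 9216 * M * n by positivity)
    linarith
  let Good : ℕ → Prop := fun i => ∃ f, E.lat.Mem f ∧
    (∀ x, x ∉ Ioo (t i) (t (i + 1)) → f x = 0) ∧
      (∀ x ∈ Ioo a b, x ∉ Ioo (t i) (t (i + 1)) → ∫ s in a..x, f s * u s = 0) ∧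
      0 < E.lat.nrm (fun x => v x * ∫ s in a..x, f s * u s) ∧
      E.lat.nrm f ≤ κ * E.lat.nrm (fun x => v x * ∫ s in a..x, f s * u s)
  classical
  let G := (Finset.range (2 * n)).filter Good
  let Bl := ((Finset.range (2 * n)).filter fun i => ¬ Good i).filter fun i =>
    η ≤ t (i + 1) - t i
  let Bs := ((Finset.range (2 * n)).filter fun i => ¬ Good i).filter fun i =>
    ¬ η ≤ t (i + 1) - t i
  have hcard : (G.card : ℝ) + (Bl.card + Bs.card) = 2 * n := by
    have h1 := Finset.card_filter_add_card_filter_not (s := Finset.range (2 * n)) Good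
    have h2 := Finset.card_filter_add_card_filter_not
      (s := (Finset.range (2 * n)).filter fun i => ¬ Good i) (fun i => η ≤ t (i + 1) - t i)
    rw [Finset.card_range, ← h2] at h1
    exact_mod_cast h1
  have hBl : (Bl.card : ℝ) ≤ (b - a) / η := by
    rw [le_div_iff₀ hη]
    exact ht.card_long_mul_le ((Finset.filter_subset _ _).trans (Finset.filter_subset _ _))
      fun j hj => (Finset.mem_filter.1 hj).2
  have hBs : Bs.card * (W / (2 * n) / 96) ≤ 4 * (D * e) := by
    have hsum1 := hD.sum_le ht (hv.sub h.mem_q) h.mem_p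
    have hsum2 := hD.sum_le ht h.mem_q (hu.sub h.mem_p)
    have hterm : ∀ i ∈ Bs, W / (2 * n) / 96 ≤
        E.lat.nrm ((Ioo (t i) (t (i + 1))).indicator (v - q)) *
          E.assocLat.nrm ((Ioo (t i) (t (i + 1))).indicator p) +
        E.lat.nrm ((Ioo (t i) (t (i + 1))).indicator q) *
          E.assocLat.nrm ((Ioo (t i) (t (i + 1))).indicator (u - p)) := by
      intro i hi
      obtain ⟨hi1, hi2⟩ := Finset.mem_filter.1 hi
      obtain ⟨hi3, hi4⟩ := Finset.mem_filter.1 hi1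
      have hi5 := Finset.mem_range.1 hi3
      rcases h.local_lower hM0 hM hu hv hu0 (ht.left_le i) (hlt i hi5) (ht.le_right (i + 1))
        (not_le.1 hi2) with hgood | hbad
      · obtain ⟨f, h1, h2, h3, h4, h5⟩ := hgood
        rw [htW i hi5] at h5
        exact absurd ⟨f, h1, h2, h3, h4, h5.trans (mul_le_mul_of_nonneg_right hκ' h4.le)⟩ hi4
      · rwa [htW i hi5] at hbad
    calc Bs.card * (W / (2 * n) / 96) = ∑ i ∈ Bs, W / (2 * n) / 96 := by simp
      _ ≤ _ := Finset.sum_le_sum hterm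
      _ ≤ _ := Finset.sum_le_sum_of_subset_of_nonneg
          ((Finset.filter_subset _ _).trans (Finset.filter_subset _ _)) fun i _ _ =>
          add_nonneg (mul_nonneg (E.lat.nrm_nonneg _) (E.assocLat.nrm_nonneg _))
            (mul_nonneg (E.lat.nrm_nonneg _) (E.assocLat.nrm_nonneg _))
      _ ≤ 2 * D * e + 2 * D * e := by
          rw [Finset.sum_add_distrib]
          exact add_le_add
            (hsum1.trans (mul_le_mul_of_nonneg_left h.err_v_p (by positivity)))
            (hsum2.trans (mul_le_mul_of_nonneg_left h.err_q_u (by positivity)))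
      _ = _ := by ring
  have hBs' : (Bs.card : ℝ) ≤ n / 2 := by
    have h1 : (n : ℝ) / 2 * (W / (2 * n) / 96) = W / 384 := by
      field_simp
      norm_num
    have h2 : 4 * (D * e) ≤ (n : ℝ) / 2 * (W / (2 * n) / 96) := by
      rw [h1]
      linarith
    exact le_of_mul_le_mul_right (hBs.trans h2) (by positivity)
  have hG : n ≤ G.card := by
    have : (n : ℝ) ≤ G.card := by linarith
    exact_mod_cast this
  obtain ⟨S, hSG, hS⟩ := Finset.exists_subset_card_eq hG
  have key := le_isomorphismNumber_hardy hD0 hD hu hv ht hκ S fun i hi =>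
    (Finset.mem_filter.1 (hSG hi)).2
  rw [hS] at key
  calc ENNReal.ofReal ((9216 * D * M)⁻¹ * I) = n * ENNReal.ofReal (D * κ)⁻¹ := by
        rw [← ENNReal.ofReal_natCast n, ← ENNReal.ofReal_mul hnpos.le]
        congr 1
        simp only [κ]
        field_simp
    _ ≤ _ := by gcongr

theorem integral_mul_pos (hab : a < b) (hu : E.assocLat.Mem u) (hv : E.lat.Mem v)
    (hu0 : ∀ᵐ x ∂lebesgueOn a b, 0 < u x) (hv0 : ∀ᵐ x ∂lebesgueOn a b, 0 < v x) :
    0 < ∫ x in a..b, u x * v x := by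
  have hint : IntervalIntegrable (fun x => u x * v x) volume a b := by
    refine intervalIntegrable_of_mem ?_ ⟨le_rfl, hab.le⟩ ⟨hab.le, le_rfl⟩
    simpa only [mul_comm] using integrable_mul hv hu
  have hpos : ∀ᵐ x ∂lebesgueOn a b, 0 < u x * v x := by
    filter_upwards [hu0, hv0] with x hx hy using mul_pos hx hy
  have hae : ∀ᵐ x ∂(volume.restrict (Ioc a b)), 0 < u x * v x := by
    rwa [← Measure.restrict_congr_set (Ioo_ae_eq_Ioc (μ := volume) (a := a) (b := b))]
  rw [intervalIntegral.integral_of_le hab.le, integral_pos_iff_support_of_nonneg_ae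
    (hae.mono fun x hx => hx.le) hint.1]
  have hsupp : (Function.support fun x => u x * v x) =ᵐ[volume.restrict (Ioc a b)] univ := by
    filter_upwards [hae] with x hx
    exact propext ⟨fun _ => mem_univ x, fun _ => hx.ne'⟩
  rw [measure_congr hsupp, Measure.restrict_apply_univ, Real.volume_Ioc]
  simpa using hab

end BanachFunctionSpace

/-! ### Two-sided estimate for all five s-numbers -/

theorem mainTheorem1 (a b : ℝ) (hab : a < b) (E : BanachFunctionSpace a b)
    (hM : E.InClassM)
    (hE : StrictConvexSpace ℝ E.Space)
    (hEdual : StrictConvexSpace ℝ (StrongDual ℝ E.Space))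
    (hAC : E.HasACNorm) (hAC' : E.AssocHasACNorm) :
    ∃ C₁ C₂ : ℝ, 0 < C₁ ∧ 0 < C₂ ∧
      ∀ u v : ℝ → ℝ, E.MemAssoc u → E.Mem v →
        (∀ᵐ x ∂(lebesgueOn a b), 0 < u x) → (∀ᵐ x ∂(lebesgueOn a b), 0 < v x) →
        IntegrableOn (fun x => u x * v x) (Ioo a b) ∧
        ∃ T : E.Space →L[ℝ] E.Space,
          (∀ f : E.Space, (∀ x ∈ Ioo a b, IntervalIntegrable (fun t => f t * u t) volume a x) ∧
            T f =ᵐ[lebesgueOn a b] fun x => v x * ∫ t in a..x, f t * u t) ∧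
          ∀ k : SNumberKind,
            ENNReal.ofReal (C₁ * ∫ x in a..b, u x * v x) ≤
                liminf (fun n : ℕ => (n : ℝ≥0∞) * sNumber k n T) atTop ∧
              liminf (fun n : ℕ => (n : ℝ≥0∞) * sNumber k n T) atTop ≤
                limsup (fun n : ℕ => (n : ℝ≥0∞) * sNumber k n T) atTop ∧
              limsup (fun n : ℕ => (n : ℝ≥0∞) * sNumber k n T) atTop ≤
                ENNReal.ofReal (C₂ * ∫ x in a..b, u x * v x) := by
  obtain ⟨M, hM0, hMb⟩ := hM.1.exists_bound
  obtain ⟨D, hD0, hDb⟩ := hM.2.exists_cellwiseBound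
  -- Both constants involve only the Muckenhoupt constant `M` and the localisation constant `D`,
  -- fixed before `u` and `v` are introduced.
  refine ⟨(9216 * D * M)⁻¹, 4 * D * (24 * M + 1), by positivity, by positivity,
    fun u v hu hv hu0 hv0 => ?_⟩
  have hu' : E.assocLat.Mem u := BanachFunctionSpace.memAssoc_iff.1 hu
  have hv' : E.lat.Mem v := hv
  have hI := BanachFunctionSpace.integral_mul_pos hab hu' hv' hu0 hv0
  refine ⟨?_, BanachFunctionSpace.hardy hu' hv', fun f => ⟨fun x hx => ?_,
    BanachFunctionSpace.coe_hardy hu' hv' f⟩, fun k => ⟨?_, liminf_le_limsup, ?_⟩⟩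
  · simpa only [IntegrableOn, mul_comm] using BanachFunctionSpace.integrable_mul hv' hu'
  · exact BanachFunctionSpace.intervalIntegrable_of_mem
      (BanachFunctionSpace.integrable_mul (BanachFunctionSpace.mem_coe f) hu')
      ⟨le_rfl, (hx.1.trans hx.2).le⟩ ⟨hx.1.le, hx.2.le⟩
  · refine le_liminf_of_le (by isBoundedDefault) ?_
    filter_upwards [BanachFunctionSpace.eventually_le_isomorphismNumber hab hM0 hMb hD0 hDb hAC
      hAC' hu' hv' hu0 hv0 hI, eventually_gt_atTop 0] with n hn hn0
    exact hn.trans (mul_le_mul_right (isomorphismNumber_le_sNumber k hn0 _) _)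
  · refine limsup_le_of_le (by isBoundedDefault) ?_
    filter_upwards [BanachFunctionSpace.eventually_approximationNumber_le hab hM0.le hMb hD0.le
      hDb hAC hAC' hu' hv' hu0 hv0 hI] with n hn
    exact (mul_le_mul_right (sNumber_le_approximationNumber k n _) _).trans hn
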